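/- Let $X=\mathbb R/\mathbb Z$ and let $T_0:X\to X$ be an orientation preserving $C^5$ expanding map (that is, $T_0'>1$ everywhere; its degree is then at least $2$). For an expanding map $T$ let $(\mathcal L_T w)(x)=\sum_{Ty=x} w(y)/T'(y)$ be its transfer operator; an invariant density of $T$ is a nonnegative $\rho\in L^1(X)$ with $\int_X\rho\,dx=1$ and $\mathcal L_T\rho=\rho$ almost everywhere. Then for every $\rho^{(1)}\in C^3(X,\mathbb R)$ with $\int_X\rho^{(1)}dx=0$ there is $\varepsilon\in C^4(X,\mathbb R)$ which realises $\rho^{(1)}$ as the first-order change of the density, in the following sense. There exist $\eta>0$ and a family $(T_\delta)_{\delta\in(-\eta,\eta)}$ of orientation preserving $C^3$ expanding maps of $X$ passing through $T_0$ at $\delta=0$ with $$T_\delta=T_0+\delta\,\varepsilon+o_{C^3}(\delta)\pmod 1\qquad(\delta\to0),$$ and for every $\eta>0$ and every such family each $T_\delta$ has an invariant density $\rho_\delta$ that is of class $C^2$ and is unique almost everywhere among invariant densities, and $$\lim_{\delta\to0}\left\|\frac{\rho_\delta-\rho_0}{\delta}-\rho^{(1)}\right\|_{L^1(X)}=0 .$$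 Here $o_{C^3}(\delta)$ denotes a remainder $r_\delta\in C^3(X,\mathbb R)$ with $\|r_\delta\|_{C^3}/|\delta|\to0$, where $\|f\|_{C^3}=\sum_{j=0}^3\sup_X|f^{(j)}|$. -/

import Mathlib

open MeasureTheory Filter Topology

noncomputable section

namespace CircleResponse

/-- `f : ℝ/ℤ → ℝ` is of class `C^k`: its 1-periodic lift to `ℝ` is. -/
def IsCk (k : ℕ) (f : UnitAddCircle → ℝ) : Prop :=
  ContDiff ℝ k (fun t : ℝ => f (t : UnitAddCircle))

/-- `T : ℝ/ℤ → ℝ/ℤ` is an orientation preserving expanding map of class `C^k` (used for `k ≥ 1`):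
it has a `C^k` lift `F : ℝ → ℝ` whose derivative is everywhere greater than `1`. By compactness
the derivative is then bounded below by some `lam > 1`, and the degree `F (x + 1) - F x` is an
integer `d ≥ 2`. -/
def IsExpandingMap (k : ℕ) (T : UnitAddCircle → UnitAddCircle) : Prop :=
  ∃ F : ℝ → ℝ, ContDiff ℝ k F ∧ (∀ t : ℝ, ((F t : ℝ) : UnitAddCircle) = T (t : UnitAddCircle)) ∧
    ∀ t : ℝ, 1 < deriv F t

/-- The representative in `(-1/2, 1/2]` of a point of `ℝ/ℤ`. -/
def rep (z : UnitAddCircle) : ℝ :=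
  (AddCircle.equivIoc (1 : ℝ) (-1 / 2) z : ℝ)

/-- The derivative `T'(y)` of a circle map at `y`, the tangent spaces of `ℝ/ℤ` being identified
with `ℝ`: the derivative at `t = 0` of `T (y + t) - T y`, read in `(-1/2, 1/2]`. -/
def circleDeriv (T : UnitAddCircle → UnitAddCircle) (y : UnitAddCircle) : ℝ :=
  deriv (fun t : ℝ => rep (T (y + (t : UnitAddCircle)) - T y)) 0

/-- The transfer operator `(L_T w)(x) = ∑_{T y = x} w(y) / T'(y)`. The sum is over the set of
preimages of `x`, which is finite for an expanding map. -/
def transfer (T : UnitAddCircle → UnitAddCircle) (w : UnitAddCircle → ℝ) (x : UnitAddCircle) : ℝ :=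
  ∑ᶠ y ∈ T ⁻¹' {x}, w y / circleDeriv T y

/-- `w` is an invariant probability density of `T`: a fixed point in `L^1` of the transfer operator,
nonnegative and of integral `1` (`volume` is the Haar probability measure of `ℝ/ℤ`). -/
structure IsInvariantDensity (T : UnitAddCircle → UnitAddCircle) (w : UnitAddCircle → ℝ) :
    Prop where
  integrable : Integrable w volume
  nonneg : 0 ≤ᵐ[volume] w
  integral_eq_one : ∫ x, w x = 1
  fixed : transfer T w =ᵐ[volume] w

/-- `w` is the `C^2` invariant density of `T`, unique among all invariant densities in `L^1`. -/
structure IsUniqueInvariantDensity (T : UnitAddCircle → UnitAddCircle) (w : UnitAddCircle → ℝ) :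
    Prop where
  smooth : IsCk 2 w
  invariant : IsInvariantDensity T w
  unique : ∀ v : UnitAddCircle → ℝ, IsInvariantDensity T v → v =ᵐ[volume] w

/-- The norm `sup |f| + sup |f'| + sup |f''| + sup |f'''|` (for `f` of class `C^3`). -/
def c3Norm (f : UnitAddCircle → ℝ) : ℝ :=
  ∑ j ∈ Finset.range 4, ⨆ t : ℝ, |iteratedDeriv j (fun s : ℝ => f (s : UnitAddCircle)) t|

/-- `(T δ)`, `δ ∈ (-η, η)`, is a family of `C^3` expanding maps through `T₀`, differentiable at
`δ = 0` with derivative `ε`: `T δ = T₀ + δ ε + r δ` modulo `1`, where the `C^3` norm of the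
remainder `r δ` is `o(δ)`. Values of `T` at `δ` outside `(-η, η)` are irrelevant. -/
structure IsPerturbation (T₀ : UnitAddCircle → UnitAddCircle) (ε : UnitAddCircle → ℝ)
    (η : ℝ) (T : ℝ → UnitAddCircle → UnitAddCircle) : Prop where
  pos : 0 < η
  zero : T 0 = T₀
  expanding : ∀ δ ∈ Set.Ioo (-η) η, IsExpandingMap 3 (T δ)
  expansion : ∃ r : ℝ → UnitAddCircle → ℝ,
    (∀ δ ∈ Set.Ioo (-η) η, IsCk 3 (r δ) ∧
      ∀ x, T δ x = T₀ x + ((δ * ε x + r δ x : ℝ) : UnitAddCircle)) ∧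
    Tendsto (fun δ : ℝ => c3Norm (r δ) / |δ|) (𝓝[≠] 0) (𝓝 0)

/-- The first order change `ε` of the map `T₀` realises the first order change `ρ₁` of the
density: there are differentiable families through `T₀` with derivative `ε`, and for every such
family `(T δ)` the invariant densities satisfy `ρ δ = ρ 0 + δ ρ₁ + o(δ)` in `L^1`. -/
def Realises (T₀ : UnitAddCircle → UnitAddCircle) (ε ρ₁ : UnitAddCircle → ℝ) : Prop :=
  (∃ (η : ℝ) (T : ℝ → UnitAddCircle → UnitAddCircle), IsPerturbation T₀ ε η T) ∧
  ∀ (η : ℝ) (T : ℝ → UnitAddCircle → UnitAddCircle), IsPerturbation T₀ ε η T →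
    ∃ ρ : ℝ → UnitAddCircle → ℝ,
      (∀ δ ∈ Set.Ioo (-η) η, IsUniqueInvariantDensity (T δ) (ρ δ)) ∧
      Tendsto (fun δ : ℝ => ∫ x, |(ρ δ x - ρ 0 x) / δ - ρ₁ x|) (𝓝[≠] 0) (𝓝 0)

end CircleResponse

end

/-!
The proof works with lifts. If `F` is a lift of degree `d` and `G = F⁻¹`, the transfer operator acts
on `1`-periodic functions by `L w (x) = ∑_{j < d} w (G (x + j)) G' (x + j)` (`branchSum G d 1`,
`LiftPair.transfer_eq`).

*Decay with uniform constants.* Let `G' ≤ θ < 1` and let `D` bound the distortion of `G`. `L` maps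
the cone of nonnegative functions with `a`-Lipschitz logarithm into the cone of width `θ a + D`. For
`a = 2 D / (1 - θ)` there is room to subtract from two functions of the same mean a fixed proportion
of that mean and to be back in the cone after one step (`inCone_coupling_step`). Hence `L^n w` decays
exponentially for Lipschitz `w` of mean zero, with constants that depend only on `θ` and `D`
(`abs_iterate_le`). This gives the invariant density as the limit of `L^n 1`, and its uniqueness in
`L^1` by smooth approximation, since `L` does not increase the `L^1` norm.

*Regularity.* Differentiating `ρ = L ρ` produces an equation `ρ' = L_2 ρ' + g` where `L_s` carries
the weight `(G')^s`; for `s ≥ 2` it contracts in the norm weighted by `ρ`. A bootstrap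
(`contDiff_of_fixed`, `contDiff_density`) shows that `ρ` is `C^m` when the map is `C^(m+1)`.

*The choice of `ε`.* To first order `L_δ w - L₀ w = -δ (L₀ (ε w))'`, so `ρ₁` is the response when
`(1 - L₀) ρ₁ = -(L₀ (ε ρ₀))'`. The left side has mean zero, so it has a periodic primitive `Q`, and
`ε = -(Q / ρ₀) ∘ F₀` satisfies `L₀ (ε ρ₀) = -Q` (`exists_perturbation`).

*Linear response.* For `u = (ρ_δ - ρ₀) / δ - ρ₁` the function `v = u - L_δ u` is an expression in
`L_δ - L₀` applied to the fixed functions `ρ₀` and `ρ₁`. It tends to `0` uniformly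
(`exists_branchSum_first_order`), and its Lipschitz constant stays bounded
(`exists_lipschitz_branchSum_sub`). Interpolating between the two, the decay of `L_δ^n`, uniform in
`δ`, gives `u → 0` uniformly (`abs_le_of_sub_branchSum`).
-/

namespace CircleResponse

/-! ### Periodic functions -/

theorem exists_abs_le_of_periodic_ne_zero {f : ℝ → ℝ} {c : ℝ} (hp : Function.Periodic f c)
    (h0 : c ≠ 0) (hc : Continuous f) : ∃ M, 0 < M ∧ ∀ x, |f x| ≤ M := by
  obtain ⟨M, hM⟩ := (hp.isBounded_of_continuous h0 hc).exists_norm_le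
  exact ⟨max M 1, by positivity, fun x => (hM _ ⟨x, rfl⟩).trans (le_max_left _ _)⟩

theorem exists_abs_le_of_periodic {f : ℝ → ℝ} (hp : Function.Periodic f 1) (hc : Continuous f) :
    ∃ M, 0 < M ∧ ∀ x, |f x| ≤ M :=
  exists_abs_le_of_periodic_ne_zero hp one_ne_zero hc

theorem periodic_deriv {f : ℝ → ℝ} {c : ℝ} (hp : Function.Periodic f c) :
    Function.Periodic (deriv f) c := by
  intro x
  rw [← deriv_comp_add_const]
  congr 1
  exact funext hp

theorem abs_sub_le_of_abs_deriv_le {f : ℝ → ℝ} (hf : Differentiable ℝ f) {M : ℝ}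
    (hM : ∀ x, |deriv f x| ≤ M) (x y : ℝ) : |f x - f y| ≤ M * |x - y| := by
  have := Convex.norm_image_sub_le_of_norm_deriv_le (s := Set.univ) (f := f) (C := M)
    (fun x _ => hf x) (fun x _ => hM x) convex_univ (Set.mem_univ y) (Set.mem_univ x)
  simpa using this

theorem exists_lipschitz_of_periodic_ne_zero {f : ℝ → ℝ} {c : ℝ} (hp : Function.Periodic f c)
    (h0 : c ≠ 0) (hf : ContDiff ℝ 1 f) : ∃ M, 0 < M ∧ ∀ x y, |f x - f y| ≤ M * |x - y| := by
  obtain ⟨M, hM0, hM⟩ := exists_abs_le_of_periodic_ne_zero (periodic_deriv hp) h0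
    (hf.continuous_deriv le_rfl)
  exact ⟨M, hM0, abs_sub_le_of_abs_deriv_le (hf.differentiable one_ne_zero) hM⟩

theorem exists_lipschitz_of_periodic {f : ℝ → ℝ} (hp : Function.Periodic f 1)
    (hf : ContDiff ℝ 1 f) : ∃ M, 0 < M ∧ ∀ x y, |f x - f y| ≤ M * |x - y| :=
  exists_lipschitz_of_periodic_ne_zero hp one_ne_zero hf

/-- Every point is at distance at most `1` from a translate of any other point. -/
theorem exists_near_of_periodic {f : ℝ → ℝ} (hp : Function.Periodic f 1) (x y : ℝ) :
    ∃ z, |x - z| ≤ 1 ∧ f z = f y := by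
  refine ⟨y + ⌊x - y⌋, ?_, ?_⟩
  · have h1 := Int.floor_le (x - y)
    have h2 := Int.lt_floor_add_one (x - y)
    rw [abs_le]; constructor <;> linarith
  · simpa using hp.int_mul ⌊x - y⌋ y

/-! ### The transfer operator in terms of an inverse lift -/

/-- The transfer operator read on `1`-periodic functions, with a general power of the weight:
`w ↦ ∑_{j < d} w (G (x + j)) (G' (x + j))^s`, where `G` is the inverse of a lift of degree `d`.
For `s = 1` it is the transfer operator; the higher powers come up when it is differentiated. -/
noncomputable def branchSum (G : ℝ → ℝ) (d s : ℕ) (w : ℝ → ℝ) (x : ℝ) : ℝ :=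
  ∑ j ∈ Finset.range d, w (G (x + j)) * deriv G (x + j) ^ s

theorem branchSum_sub {G : ℝ → ℝ} {d s : ℕ} (v w : ℝ → ℝ) (x : ℝ) :
    branchSum G d s (fun t => v t - w t) x = branchSum G d s v x - branchSum G d s w x := by
  simp only [branchSum, ← Finset.sum_sub_distrib, sub_mul]

theorem branchSum_const_mul {G : ℝ → ℝ} {d s : ℕ} (c : ℝ) (w : ℝ → ℝ) (x : ℝ) :
    branchSum G d s (fun t => c * w t) x = c * branchSum G d s w x := by
  simp only [branchSum, Finset.mul_sum, mul_assoc]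

/-- A `d`-periodic function summed over the `d` integer translates is `1`-periodic. -/
theorem periodic_sum_range {h : ℝ → ℝ} {d : ℕ} (hh : Function.Periodic h d) :
    Function.Periodic (fun x => ∑ j ∈ Finset.range d, h (x + j)) 1 := by
  intro x
  have h1 : ∑ j ∈ Finset.range d, h (x + 1 + j) = ∑ j ∈ Finset.range d, h (x + (j + 1 : ℕ)) :=
    Finset.sum_congr rfl fun j _ => by push_cast; ring_nf
  have h2 := Finset.sum_range_succ (fun j : ℕ => h (x + j)) d
  rw [Finset.sum_range_succ'] at h2
  have h3 := hh x
  simp only [Nat.cast_zero, add_zero] at h2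
  show ∑ j ∈ Finset.range d, h (x + 1 + j) = _
  rw [h1]; linarith

/-- `G` is the inverse of a lift of degree `d` of an expanding circle map: `G' ≤ θ < 1`, and the
distortion of `G` is controlled by the constant `D`. -/
structure InverseLift (G : ℝ → ℝ) (d : ℕ) (θ D : ℝ) : Prop where
  contDiff : ContDiff ℝ 1 G
  add_degree : ∀ x, G (x + d) = G x + 1
  deriv_pos : ∀ x, 0 < deriv G x
  deriv_le : ∀ x, deriv G x ≤ θ
  lt_one : θ < 1
  pos : 0 < D
  distortion : ∀ x y, deriv G x ≤ Real.exp (D * |x - y|) * deriv G y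

namespace InverseLift

variable {G : ℝ → ℝ} {d : ℕ} {θ D : ℝ} (hG : InverseLift G d θ D)
include hG

theorem theta_pos : 0 < θ := (hG.deriv_pos 0).trans_le (hG.deriv_le 0)

theorem differentiable : Differentiable ℝ G := hG.contDiff.differentiable one_ne_zero

theorem continuous : Continuous G := hG.contDiff.continuous

theorem continuous_deriv : Continuous (deriv G) := hG.contDiff.continuous_deriv le_rfl

theorem abs_sub_le (x y : ℝ) : |G x - G y| ≤ θ * |x - y| :=
  abs_sub_le_of_abs_deriv_le hG.differentiable
    (fun x => by rw [abs_of_pos (hG.deriv_pos x)]; exact hG.deriv_le x) x y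

theorem strictMono : StrictMono G := strictMono_of_deriv_pos hG.deriv_pos

theorem deriv_periodic : Function.Periodic (deriv G) d := by
  intro x
  rw [← deriv_comp_add_const, show (fun x => G (x + d)) = fun x => G x + 1 from
    funext hG.add_degree, deriv_add_const]

theorem branch_periodic {w : ℝ → ℝ} (hw : Function.Periodic w 1) (s : ℕ) :
    Function.Periodic (fun x => w (G x) * deriv G x ^ s) d := by
  intro x
  simp only [hG.add_degree, hw (G x), hG.deriv_periodic x]

theorem periodic {w : ℝ → ℝ} (hw : Function.Periodic w 1) (s : ℕ) :
    Function.Periodic (branchSum G d s w) 1 :=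
  periodic_sum_range (hG.branch_periodic hw s)

theorem continuous_branchSum {w : ℝ → ℝ} (hw : Continuous w) (s : ℕ) :
    Continuous (branchSum G d s w) := by
  have h1 := hG.continuous
  have h2 := hG.continuous_deriv
  unfold branchSum
  fun_prop

theorem branchSum_mono {s : ℕ} {v w : ℝ → ℝ} (h : ∀ x, v x ≤ w x) (x : ℝ) :
    branchSum G d s v x ≤ branchSum G d s w x :=
  Finset.sum_le_sum fun _ _ =>
    mul_le_mul_of_nonneg_right (h _) (pow_nonneg (hG.deriv_pos _).le _)

theorem abs_branchSum_le (s : ℕ) (w : ℝ → ℝ) (x : ℝ) :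
    |branchSum G d s w x| ≤ branchSum G d s (fun t => |w t|) x := by
  refine (Finset.abs_sum_le_sum_abs _ _).trans_eq (Finset.sum_congr rfl fun j _ => ?_)
  rw [abs_mul, abs_of_nonneg (pow_nonneg (hG.deriv_pos _).le _)]

/-- An extra power of the weight contracts. -/
theorem branchSum_le_pow_mul {w : ℝ → ℝ} (hw : ∀ x, 0 ≤ w x) (s r : ℕ) (x : ℝ) :
    branchSum G d (s + r) w x ≤ θ ^ r * branchSum G d s w x := by
  rw [branchSum, branchSum, Finset.mul_sum]
  refine Finset.sum_le_sum fun j _ => ?_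
  have h0 := (hG.deriv_pos (x + j)).le
  have h1 := pow_le_pow_left₀ h0 (hG.deriv_le (x + j)) r
  calc w (G (x + j)) * deriv G (x + j) ^ (s + r)
      = deriv G (x + j) ^ r * (w (G (x + j)) * deriv G (x + j) ^ s) := by ring
    _ ≤ _ := mul_le_mul_of_nonneg_right h1 (mul_nonneg (hw _) (pow_nonneg h0 _))

/-! ### Conservation of the integral -/

theorem intervalIntegrable_branch {w : ℝ → ℝ} (hp : Function.Periodic w 1)
    (hw : IntervalIntegrable w volume 0 1) (a b : ℝ) :
    IntervalIntegrable (fun x => w (G x) * deriv G x) volume a b := by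
  have key : ∀ a b : ℝ, a ≤ b → IntervalIntegrable (fun x => w (G x) * deriv G x) volume a b := by
    intro a b hab
    rw [intervalIntegrable_iff_integrableOn_Icc_of_le hab]
    have h := integrableOn_image_iff_integrableOn_abs_deriv_smul (s := Set.Icc a b)
      measurableSet_Icc (fun x _ => (hG.differentiable x).hasDerivAt.hasDerivWithinAt)
      hG.strictMono.injective.injOn w
    have h2 : IntegrableOn w (G '' Set.Icc a b) := by
      have h3 := hp.intervalIntegrable one_ne_zero (t := 0) (by simpa using hw) (G a) (G b)
      rw [intervalIntegrable_iff_integrableOn_Icc_of_le (hG.strictMono.monotone hab)] at h3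
      refine h3.mono_set ?_
      rintro _ ⟨x, hx, rfl⟩
      exact ⟨hG.strictMono.monotone hx.1, hG.strictMono.monotone hx.2⟩
    refine (h.1 h2).congr_fun (fun x _ => ?_) measurableSet_Icc
    simp only [smul_eq_mul, abs_of_pos (hG.deriv_pos x)]
    ring
  rcases le_total a b with h | h
  · exact key a b h
  · exact (key b a h).symm

theorem intervalIntegrable {w : ℝ → ℝ} (hp : Function.Periodic w 1)
    (hw : IntervalIntegrable w volume 0 1) (a b : ℝ) :
    IntervalIntegrable (branchSum G d 1 w) volume a b := by
  have h : branchSum G d 1 w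
      = ∑ j ∈ Finset.range d, fun x => w (G (x + j)) * deriv G (x + j) := by
    ext x; simp [branchSum]
  rw [h]
  refine IntervalIntegrable.sum _ fun j _ => ?_
  have h2 := (hG.intervalIntegrable_branch hp hw (a + j) (b + j)).comp_add_right (j : ℝ)
  simpa using h2

/-- The transfer operator preserves the integral over a period. -/
theorem integral_branchSum {w : ℝ → ℝ} (hp : Function.Periodic w 1)
    (hw : IntervalIntegrable w volume 0 1) :
    ∫ x in (0 : ℝ)..1, branchSum G d 1 w x = ∫ x in (0 : ℝ)..1, w x := by
  have hi := hG.intervalIntegrable_branch hp hw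
  have h1 : ∫ x in (0 : ℝ)..1, branchSum G d 1 w x
      = ∑ j ∈ Finset.range d, ∫ x in (0 : ℝ)..1, w (G (x + j)) * deriv G (x + j) := by
    rw [← intervalIntegral.integral_finsetSum]
    · simp [branchSum]
    · intro j _
      have h2 := (hi (0 + j) (1 + j)).comp_add_right (j : ℝ)
      simpa using h2
  have h2 : ∀ j : ℕ, ∫ x in (0 : ℝ)..1, w (G (x + j)) * deriv G (x + j)
      = ∫ x in ((j : ℕ) : ℝ)..((j + 1 : ℕ) : ℝ), w (G x) * deriv G x := by
    intro j
    rw [intervalIntegral.integral_comp_add_right (fun x => w (G x) * deriv G x)]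
    congr 1 <;> push_cast <;> ring
  simp only [h1, h2]
  rw [intervalIntegral.sum_integral_adjacent_intervals (a := fun j : ℕ => (j : ℝ))
    fun j _ => hi _ _]
  have hd : (0 : ℝ) ≤ (d : ℝ) := Nat.cast_nonneg d
  have hGd : G d = G 0 + 1 := by simpa using hG.add_degree 0
  have himg : G '' Set.Icc 0 (d : ℝ) = Set.Icc (G 0) (G 0 + 1) := by
    rw [← hGd]
    refine Set.Subset.antisymm ?_ (intermediate_value_Icc hd hG.continuous.continuousOn)
    rintro _ ⟨x, hx, rfl⟩
    exact ⟨hG.strictMono.monotone hx.1, hG.strictMono.monotone hx.2⟩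
  have h3 := integral_image_eq_integral_abs_deriv_smul (s := Set.Icc 0 (d : ℝ))
      measurableSet_Icc (fun x _ => (hG.differentiable x).hasDerivAt.hasDerivWithinAt)
      hG.strictMono.injective.injOn w
  rw [himg, integral_Icc_eq_integral_Ioc, integral_Icc_eq_integral_Ioc,
    ← intervalIntegral.integral_of_le (by linarith),
    ← intervalIntegral.integral_of_le hd, hp.intervalIntegral_add_eq (G 0) 0, zero_add] at h3
  rw [h3]
  simp only [Nat.cast_zero]
  refine intervalIntegral.integral_congr fun x _ => ?_
  simp only [smul_eq_mul, abs_of_pos (hG.deriv_pos x)]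
  ring

theorem integral_abs_branchSum_le {w : ℝ → ℝ} (hp : Function.Periodic w 1)
    (hw : IntervalIntegrable w volume 0 1) :
    ∫ x in (0 : ℝ)..1, |branchSum G d 1 w x| ≤ ∫ x in (0 : ℝ)..1, |w x| := by
  have hp' : Function.Periodic (fun x => |w x|) 1 := fun x => by simp only [hp x]
  rw [← hG.integral_branchSum hp' hw.abs]
  exact intervalIntegral.integral_mono_on zero_le_one (hG.intervalIntegrable hp hw 0 1).abs
    (hG.intervalIntegrable hp' hw.abs 0 1) fun x _ => hG.abs_branchSum_le 1 w x

end InverseLift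

/-! ### The cone of functions with Lipschitz logarithm -/

/-- The `1`-periodic continuous functions `f ≥ 0` of mean `m` whose logarithm is `a`-Lipschitz; the
last condition is written multiplicatively, so that `f = 0` is allowed. -/
structure InCone (a m : ℝ) (f : ℝ → ℝ) : Prop where
  continuous : Continuous f
  periodic : Function.Periodic f 1
  nonneg : ∀ x, 0 ≤ f x
  logLip : ∀ x y, f x ≤ Real.exp (a * |x - y|) * f y
  integral : ∫ x in (0 : ℝ)..1, f x = m

theorem integral_le_of_le {f : ℝ → ℝ} (hf : IntervalIntegrable f volume 0 1) {c : ℝ}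
    (h : ∀ x, f x ≤ c) : ∫ x in (0 : ℝ)..1, f x ≤ c := by
  have := intervalIntegral.integral_mono_on zero_le_one hf
    (intervalIntegrable_const (c := c)) fun x _ => h x
  simpa using this

theorem le_integral_of_le {f : ℝ → ℝ} (hf : IntervalIntegrable f volume 0 1) {c : ℝ}
    (h : ∀ x, c ≤ f x) : c ≤ ∫ x in (0 : ℝ)..1, f x := by
  have := intervalIntegral.integral_mono_on zero_le_one
    (intervalIntegrable_const (c := c)) hf fun x _ => h x
  simpa using this

namespace InCone

variable {a m : ℝ} {f : ℝ → ℝ}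

theorem intervalIntegrable (hf : InCone a m f) (s t : ℝ) : IntervalIntegrable f volume s t :=
  hf.continuous.intervalIntegrable s t

theorem mean_nonneg (hf : InCone a m f) : 0 ≤ m := by
  rw [← hf.integral]; exact le_integral_of_le (hf.intervalIntegrable 0 1) hf.nonneg

theorem le_exp_mul (hf : InCone a m f) (ha : 0 ≤ a) (x y : ℝ) : f x ≤ Real.exp a * f y := by
  obtain ⟨z, hz, hzy⟩ := exists_near_of_periodic hf.periodic x y
  rw [← hzy]
  refine (hf.logLip x z).trans (mul_le_mul_of_nonneg_right (Real.exp_le_exp.2 ?_) (hf.nonneg z))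
  nlinarith

theorem le (hf : InCone a m f) (ha : 0 ≤ a) (x : ℝ) : f x ≤ Real.exp a * m := by
  rw [← hf.integral, ← intervalIntegral.integral_const_mul]
  exact le_integral_of_le ((hf.intervalIntegrable 0 1).const_mul _) (hf.le_exp_mul ha x)

theorem ge (hf : InCone a m f) (ha : 0 ≤ a) (y : ℝ) : Real.exp (-a) * m ≤ f y := by
  rw [Real.exp_neg, inv_mul_le_iff₀ (Real.exp_pos a), ← hf.integral]
  exact integral_le_of_le (hf.intervalIntegrable 0 1) fun x => hf.le_exp_mul ha x y

theorem mono {b : ℝ} (hf : InCone a m f) (hab : a ≤ b) : InCone b m f :=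
  { hf with
    logLip := fun x y => (hf.logLip x y).trans (mul_le_mul_of_nonneg_right
      (Real.exp_le_exp.2 (mul_le_mul_of_nonneg_right hab (abs_nonneg _))) (hf.nonneg y)) }

theorem const {c : ℝ} (hc : 0 ≤ c) (ha : 0 ≤ a) : InCone a c fun _ => c where
  continuous := continuous_const
  periodic _ := rfl
  nonneg _ := hc
  logLip x y := le_mul_of_one_le_left hc (Real.one_le_exp (by positivity))
  integral := by simp

/-- A fixed proportion of the mean can be subtracted at the cost of a slightly wider cone. -/
theorem sub_const (hf : InCone a m f) (ha : 0 ≤ a) {τ c : ℝ} (hτ : 0 < τ)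
    (hc : c * (1 + τ) = τ) :
    InCone ((1 + τ) * a) ((1 - c * Real.exp (-a)) * m) fun x => f x - c * Real.exp (-a) * m := by
  have hc0 : 0 < c := by
    by_contra h
    nlinarith
  have hm := hf.mean_nonneg
  have hc1 : c ≤ 1 := by nlinarith
  have hge := hf.ge ha
  have hem : 0 ≤ Real.exp (-a) * m := by positivity
  set k := c * Real.exp (-a) * m with hk
  have hk0 : 0 ≤ k := by positivity
  have hkf : ∀ y, k * (1 + τ) ≤ τ * f y := by
    intro y
    have h1 : k * (1 + τ) = τ * (Real.exp (-a) * m) := by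
      rw [hk]; linear_combination (Real.exp (-a) * m) * hc
    rw [h1]
    exact mul_le_mul_of_nonneg_left (hge y) hτ.le
  refine ⟨hf.continuous.sub continuous_const, fun x => by simp only [hf.periodic x], fun x => ?_,
    fun x y => ?_, ?_⟩
  · have : k ≤ Real.exp (-a) * m := by rw [hk]; nlinarith
    linarith [hge x]
  · have h0 := hf.logLip x y
    have hb : 0 ≤ a * |x - y| := by positivity
    set b := a * |x - y| with hbdef
    have he : Real.exp ((1 + τ) * a * |x - y|) = Real.exp b * Real.exp (τ * b) := by
      rw [← Real.exp_add, hbdef]; ring_nf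
    rw [he]
    have hs : Real.exp b - 1 ≤ Real.exp b * b := by
      have h1 := Real.add_one_le_exp (-b)
      have h2 : Real.exp b * Real.exp (-b) = 1 := by rw [← Real.exp_add]; simp
      have h3 := Real.exp_pos b
      nlinarith
    have hp := Real.add_one_le_exp (τ * b)
    have hs0 := Real.exp_pos b
    set s := Real.exp b
    set p := Real.exp (τ * b)
    have h4 : τ * (s - 1) ≤ s * (p - 1) := by
      calc τ * (s - 1) ≤ τ * (s * b) := mul_le_mul_of_nonneg_left hs hτ.le
        _ = s * (τ * b) := by ring
        _ ≤ s * (p - 1) := mul_le_mul_of_nonneg_left (by linarith) hs0.le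
    have hp1 : 0 ≤ s * (p - 1) := mul_nonneg hs0.le (by nlinarith [mul_nonneg hτ.le hb])
    have h5 := mul_le_mul_of_nonneg_left (hkf y) hp1
    have h6 := mul_le_mul_of_nonneg_left h4 hk0
    have h7 : τ * (k * (s * p - 1)) ≤ τ * (s * (p - 1) * f y) := by nlinarith
    have h8 := le_of_mul_le_mul_left h7 hτ
    nlinarith
  · rw [intervalIntegral.integral_sub (hf.intervalIntegrable 0 1) intervalIntegrable_const,
      hf.integral]
    simp [hk]; ring

/-- A Lipschitz function becomes an element of the cone after adding a constant. -/
theorem of_lipschitz {w : ℝ → ℝ} (hp : Function.Periodic w 1) (ha : 0 < a) {M l : ℝ} (hl : 0 ≤ l)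
    (hM : ∀ x, |w x| ≤ M) (hw : ∀ x y, |w x - w y| ≤ l * |x - y|) (hc : Continuous w) :
    InCone a ((∫ x in (0 : ℝ)..1, w x) + (M + l / a)) fun x => w x + (M + l / a) where
  continuous := hc.add continuous_const
  periodic x := by simp only [hp x]
  nonneg x := by
    have h1 := (abs_le.1 (hM x)).1
    have h2 : 0 ≤ l / a := by positivity
    linarith
  logLip x y := by
    have h1 := (abs_le.1 (hM y)).1
    have h2 : l ≤ a * (w y + (M + l / a)) := by
      have : a * (l / a) = l := by field_simp
      nlinarith
    have h3 := Real.add_one_le_exp (a * |x - y|)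
    have h4 := (abs_le.1 (hw x y)).2
    have h5 := mul_le_mul_of_nonneg_right h2 (abs_nonneg (x - y))
    have h6 : 0 ≤ w y + (M + l / a) := by
      have : 0 ≤ l / a := by positivity
      linarith
    have h7 := mul_le_mul_of_nonneg_right h3 h6
    nlinarith
  integral := by
    rw [intervalIntegral.integral_add (hc.intervalIntegrable 0 1) intervalIntegrable_const]
    simp

end InCone

/-! ### Coupling -/

/-- The width of a cone that the transfer operator of an inverse lift with constants `θ`, `D` maps
strictly inside itself. -/
noncomputable def coneWidth (θ D : ℝ) : ℝ := 2 * D / (1 - θ)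

/-- The factor by which one step of the transfer operator reduces the uncoupled mass. -/
noncomputable def couplingRate (θ D : ℝ) : ℝ :=
  1 - (1 - θ) / (1 + θ) * Real.exp (-coneWidth θ D)

namespace InverseLift

variable {G : ℝ → ℝ} {d : ℕ} {θ D : ℝ} (hG : InverseLift G d θ D)
include hG

theorem coneWidth_pos : 0 < coneWidth θ D :=
  div_pos (by linarith [hG.pos]) (by linarith [hG.lt_one])

theorem couplingRate_nonneg : 0 ≤ couplingRate θ D := by
  have h0 := hG.theta_pos
  have h1 := hG.lt_one
  have h2 : (1 - θ) / (1 + θ) ≤ 1 := by rw [div_le_one (by linarith)]; linarith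
  have h3 : Real.exp (-coneWidth θ D) ≤ 1 := Real.exp_le_one_iff.2 (by linarith [hG.coneWidth_pos])
  have h4 : 0 ≤ (1 - θ) / (1 + θ) := div_nonneg (by linarith) (by linarith)
  have := mul_le_one₀ h2 (Real.exp_pos _).le h3
  rw [couplingRate]; linarith

theorem couplingRate_lt_one : couplingRate θ D < 1 := by
  have h0 := hG.theta_pos
  have h1 := hG.lt_one
  have : 0 < (1 - θ) / (1 + θ) * Real.exp (-coneWidth θ D) :=
    mul_pos (div_pos (by linarith) (by linarith)) (Real.exp_pos _)
  rw [couplingRate]; linarith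

/-- The expansion narrows the cone, the distortion widens it by at most `D`. -/
theorem inCone_map {b m : ℝ} {f : ℝ → ℝ} (hb : 0 ≤ b) (hf : InCone b m f) :
    InCone (θ * b + D) m (branchSum G d 1 f) where
  continuous := hG.continuous_branchSum hf.continuous 1
  periodic := hG.periodic hf.periodic 1
  nonneg x := Finset.sum_nonneg fun j _ =>
    mul_nonneg (hf.nonneg _) (pow_nonneg (hG.deriv_pos _).le _)
  logLip x y := by
    rw [branchSum, branchSum, Finset.mul_sum]
    refine Finset.sum_le_sum fun j _ => ?_
    have h1 := hf.logLip (G (x + j)) (G (y + j))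
    have h2 := hG.distortion (x + j) (y + j)
    have h3 := hG.abs_sub_le (x + j) (y + j)
    rw [add_sub_add_right_eq_sub] at h2 h3
    have h4 : Real.exp (b * |G (x + j) - G (y + j)|) ≤ Real.exp (b * (θ * |x - y|)) :=
      Real.exp_le_exp.2 (mul_le_mul_of_nonneg_left h3 hb)
    have h5 := h1.trans (mul_le_mul_of_nonneg_right h4 (hf.nonneg _))
    have h6 := mul_le_mul h5 h2 (hG.deriv_pos _).le
      (mul_nonneg (Real.exp_pos _).le (hf.nonneg _))
    simp only [pow_one]
    refine h6.trans_eq ?_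
    rw [show (θ * b + D) * |x - y| = b * (θ * |x - y|) + D * |x - y| by ring, Real.exp_add]
    ring
  integral := by
    rw [hG.integral_branchSum hf.periodic (hf.intervalIntegrable 0 1), hf.integral]

theorem inCone_map_self {m : ℝ} {f : ℝ → ℝ} (hf : InCone (coneWidth θ D) m f) :
    InCone (coneWidth θ D) m (branchSum G d 1 f) := by
  refine (hG.inCone_map hG.coneWidth_pos.le hf).mono ?_
  have h1 := hG.lt_one
  have h2 : coneWidth θ D * (1 - θ) = 2 * D := by
    rw [coneWidth]; field_simp [(by linarith : (1 - θ) ≠ 0)]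
  linarith [hG.pos]

theorem inCone_iterate {m : ℝ} {f : ℝ → ℝ} (hf : InCone (coneWidth θ D) m f) (n : ℕ) :
    InCone (coneWidth θ D) m ((branchSum G d 1)^[n] f) := by
  induction n with
  | zero => exact hf
  | succ n ih => rw [Function.iterate_succ_apply']; exact hG.inCone_map_self ih

/-- Subtracting the common part and applying the transfer operator leads back into the cone. -/
theorem inCone_coupling_step {m : ℝ} {f : ℝ → ℝ} (hf : InCone (coneWidth θ D) m f) :
    InCone (coneWidth θ D) (couplingRate θ D * m)
      (branchSum G d 1
        fun x => f x - (1 - θ) / (1 + θ) * Real.exp (-coneWidth θ D) * m) := by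
  have h0 := hG.theta_pos
  have h1 := hG.lt_one
  have ha := hG.coneWidth_pos
  have hτ : 0 < (1 - θ) / (2 * θ) := div_pos (by linarith) (by linarith)
  have h2 := hf.sub_const ha.le hτ (c := (1 - θ) / (1 + θ)) (by field_simp; ring)
  refine (hG.inCone_map (by positivity) h2).mono (le_of_eq ?_)
  have h3 : coneWidth θ D * (1 - θ) = 2 * D := by
    rw [coneWidth]; field_simp [(by linarith : (1 - θ) ≠ 0)]
  have h4 : θ * ((1 + (1 - θ) / (2 * θ)) * coneWidth θ D) = (1 + θ) / 2 * coneWidth θ D := by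
    field_simp; ring
  rw [h4]; linarith

theorem exists_coupling {m : ℝ} {f g : ℝ → ℝ} (hf : InCone (coneWidth θ D) m f)
    (hg : InCone (coneWidth θ D) m g) (n : ℕ) :
    ∃ f' g', InCone (coneWidth θ D) (couplingRate θ D ^ n * m) f' ∧
      InCone (coneWidth θ D) (couplingRate θ D ^ n * m) g' ∧
      ∀ x, (branchSum G d 1)^[n] (fun t => f t - g t) x = f' x - g' x := by
  induction n with
  | zero => exact ⟨f, g, by simpa using hf, by simpa using hg, fun x => rfl⟩
  | succ n ih =>
    obtain ⟨f', g', hf', hg', h⟩ := ih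
    have e : couplingRate θ D ^ (n + 1) * m = couplingRate θ D * (couplingRate θ D ^ n * m) := by
      ring
    refine ⟨_, _, e ▸ hG.inCone_coupling_step hf', e ▸ hG.inCone_coupling_step hg', fun x => ?_⟩
    rw [Function.iterate_succ_apply', funext h, ← branchSum_sub]
    congr 1
    ext t
    ring

/-- Exponential decay of Lipschitz functions of mean zero, with constants that depend only on `θ`
and `D`. -/
theorem abs_iterate_le {w : ℝ → ℝ} (hp : Function.Periodic w 1) (hc : Continuous w) {M l : ℝ}
    (hl : 0 ≤ l) (hM : ∀ x, |w x| ≤ M) (hw : ∀ x y, |w x - w y| ≤ l * |x - y|)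
    (h0 : ∫ x in (0 : ℝ)..1, w x = 0) (n : ℕ) (x : ℝ) :
    |(branchSum G d 1)^[n] w x| ≤
      Real.exp (coneWidth θ D) * (M + l / coneWidth θ D) * couplingRate θ D ^ n := by
  have ha := hG.coneWidth_pos
  have hM0 : 0 ≤ M := (abs_nonneg _).trans (hM 0)
  have hK : 0 ≤ M + l / coneWidth θ D := by positivity
  have h1 := InCone.of_lipschitz hp ha hl hM hw hc
  rw [h0, zero_add] at h1
  obtain ⟨f, g, hf, hg, h⟩ := hG.exists_coupling h1 (InCone.const hK ha.le) n
  have h2 : (fun t => w t + (M + l / coneWidth θ D) - (M + l / coneWidth θ D)) = w := by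
    ext t; ring
  rw [h2] at h
  rw [h x, abs_le]
  have e1 := hf.le ha.le x
  have e2 := hg.le ha.le x
  have e3 := hf.nonneg x
  have e4 := hg.nonneg x
  constructor <;> nlinarith

theorem iterate_mono {v w : ℝ → ℝ} (h : ∀ x, v x ≤ w x) (n : ℕ) (x : ℝ) :
    (branchSum G d 1)^[n] v x ≤ (branchSum G d 1)^[n] w x := by
  induction n generalizing v w with
  | zero => exact h x
  | succ n ih => exact ih (hG.branchSum_mono h)

theorem abs_iterate_le_exp_mul {w : ℝ → ℝ} {M : ℝ} (hM : ∀ x, |w x| ≤ M) (n : ℕ) (x : ℝ) :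
    |(branchSum G d 1)^[n] w x| ≤ Real.exp (coneWidth θ D) * M := by
  have hM0 : 0 ≤ M := (abs_nonneg _).trans (hM 0)
  have ha := hG.coneWidth_pos.le
  have h1 := (hG.inCone_iterate (InCone.const hM0 ha) n).le ha x
  have h2 := hG.iterate_mono (fun x => (abs_le.1 (hM x)).2) n x
  have h3 := hG.iterate_mono (fun x => (abs_le.1 (hM x)).1) n x
  have h4 : ∀ (k : ℕ) (f : ℝ → ℝ), (branchSum G d 1)^[k] (fun t => -f t)
      = fun t => -(branchSum G d 1)^[k] f t := by
    intro k
    induction k with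
    | zero => intro f; rfl
    | succ k ih =>
      intro f
      rw [Function.iterate_succ_apply, Function.iterate_succ_apply, ← ih]
      congr 1
      ext t
      simp [branchSum]
  rw [h4 n] at h3
  exact abs_le.2 ⟨by linarith, by linarith⟩

end InverseLift

/-! ### The invariant density and its uniqueness -/

theorem iterate_branchSum_sub {G : ℝ → ℝ} {d : ℕ} (v w : ℝ → ℝ) (n : ℕ) (x : ℝ) :
    (branchSum G d 1)^[n] (fun t => v t - w t) x
      = (branchSum G d 1)^[n] v x - (branchSum G d 1)^[n] w x := by
  induction n generalizing v w with
  | zero => rfl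
  | succ n ih =>
    simp only [Function.iterate_succ_apply, ← ih]
    rw [show branchSum G d 1 (fun t => v t - w t) = fun t => branchSum G d 1 v t - branchSum G d 1 w t
      from funext fun t => branchSum_sub v w t]

theorem iterate_branchSum_const_mul {G : ℝ → ℝ} {d : ℕ} (c : ℝ) (w : ℝ → ℝ) (n : ℕ) (x : ℝ) :
    (branchSum G d 1)^[n] (fun t => c * w t) x = c * (branchSum G d 1)^[n] w x := by
  induction n generalizing w with
  | zero => rfl
  | succ n ih =>
    simp only [Function.iterate_succ_apply, ← ih]
    rw [show branchSum G d 1 (fun t => c * w t) = fun t => c * branchSum G d 1 w t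
      from funext fun t => branchSum_const_mul c w t]

theorem tendsto_branchSum {G : ℝ → ℝ} {d s : ℕ} {w : ℕ → ℝ → ℝ} {v : ℝ → ℝ}
    (h : ∀ x, Tendsto (fun n => w n x) atTop (𝓝 (v x))) (x : ℝ) :
    Tendsto (fun n => branchSum G d s (w n) x) atTop (𝓝 (branchSum G d s v x)) :=
  tendsto_finsetSum _ fun _ _ => (h _).mul_const _

theorem exists_limit_of_geometric {w : ℕ → ℝ → ℝ} {C q : ℝ} (hq : q < 1)
    (h : ∀ n x, |w (n + 1) x - w n x| ≤ C * q ^ n) :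
    ∃ v : ℝ → ℝ, (∀ n x, |w n x - v x| ≤ C * q ^ n / (1 - q)) ∧
      (∀ x, Tendsto (fun n => w n x) atTop (𝓝 (v x))) := by
  have hd : ∀ x n, dist (w n x) (w (n + 1) x) ≤ C * q ^ n := fun x n => by
    rw [dist_comm]; exact h n x
  choose v hv using fun x => cauchySeq_tendsto_of_complete
    (cauchySeq_of_le_geometric q C hq (hd x))
  exact ⟨v, fun n x => dist_le_of_le_geometric_of_tendsto q C hq (hd x) (hv x) n, hv⟩

theorem tendstoUniformly_of_geometric {w : ℕ → ℝ → ℝ} {v : ℝ → ℝ} {C q : ℝ} (hq0 : 0 ≤ q)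
    (hq : q < 1) (h : ∀ n x, |w n x - v x| ≤ C * q ^ n) : TendstoUniformly w v atTop := by
  rw [Metric.tendstoUniformly_iff]
  intro e he
  have h1 : Tendsto (fun n : ℕ => C * q ^ n) atTop (𝓝 (C * 0)) :=
    (tendsto_pow_atTop_nhds_zero_of_lt_one hq0 hq).const_mul C
  rw [mul_zero] at h1
  filter_upwards [h1.eventually_lt_const he] with n hn x
  rw [dist_comm]
  exact (h n x).trans_lt hn

theorem intervalIntegrable_lift {v : UnitAddCircle → ℝ} (hv : Integrable v volume) :
    IntervalIntegrable (fun x : ℝ => v (x : UnitAddCircle)) volume 0 1 := by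
  rw [intervalIntegrable_iff_integrableOn_Ioc_of_le zero_le_one]
  have := (UnitAddCircle.measurePreserving_mk 0).integrable_comp_of_integrable hv
  rw [zero_add] at this
  exact this

/-- A `1`-periodic integrable function is approximated in mean by `1`-periodic `C^1` functions: the
averages of a continuous approximation over short intervals. -/
theorem exists_contDiff_integral_abs_sub_le {v : UnitAddCircle → ℝ} (hv : Integrable v volume)
    {e : ℝ} (he : 0 < e) :
    ∃ u : ℝ → ℝ, ContDiff ℝ 1 u ∧ Function.Periodic u 1 ∧
      ∫ x in (0 : ℝ)..1, |v (x : UnitAddCircle) - u x| ≤ e := by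
  obtain ⟨g, -, hg, hgc, hgi⟩ := hv.exists_hasCompactSupport_integral_sub_le (half_pos he)
  have huc := CompactSpace.uniformContinuous_of_continuous hgc
  obtain ⟨h, hh0, hh⟩ := Metric.uniformContinuous_iff.1 huc (e / 2) (half_pos he)
  set g' : ℝ → ℝ := fun t => g (t : UnitAddCircle) with hg'
  have hc' : Continuous g' := hgc.comp (AddCircle.continuous_mk' 1)
  set H : ℝ → ℝ := fun x => ∫ t in (0 : ℝ)..x, g' t with hH
  have hHd : ∀ x, HasDerivAt H (g' x) x := fun x =>
    (hc'.integral_hasStrictDerivAt 0 x).hasDerivAt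
  have hHc : ContDiff ℝ 1 H := contDiff_one_iff_deriv.2
    ⟨fun x => (hHd x).differentiableAt, by
      rwa [show deriv H = g' from funext fun x => (hHd x).deriv]⟩
  have hp : Function.Periodic g' 1 := fun x => by
    simp only [hg', AddCircle.coe_add, AddCircle.coe_period, add_zero]
  refine ⟨fun x => (H (x + h / 2) - H x) / (h / 2), by fun_prop, fun x => ?_, ?_⟩
  · have : ∀ y, H (y + 1) = H y + ∫ t in (0 : ℝ)..1, g' t := by
      intro y
      simp only [hH]
      rw [← intervalIntegral.integral_add_adjacent_intervals (hc'.intervalIntegrable 0 y)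
        (hc'.intervalIntegrable y (y + 1)), hp.intervalIntegral_add_eq y 0, zero_add]
    simp only [show x + 1 + h / 2 = x + h / 2 + 1 by ring, this]
    ring
  · have hclose : ∀ x, |g' x - (H (x + h / 2) - H x) / (h / 2)| ≤ e / 2 := by
      intro x
      obtain ⟨c, hcm, hce⟩ := exists_deriv_eq_slope H (show x < x + h / 2 by linarith)
        hHc.continuous.continuousOn (hHc.differentiable one_ne_zero).differentiableOn
      rw [(hHd c).deriv, add_sub_cancel_left] at hce
      rw [← hce]
      refine (hh (a := (x : UnitAddCircle)) (b := (c : UnitAddCircle)) ?_).le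
      rw [dist_eq_norm, ← AddCircle.coe_sub]
      refine (QuotientAddGroup.norm_mk_le_norm).trans_lt ?_
      rw [Real.norm_eq_abs, abs_lt]
      constructor <;> linarith [hcm.1, hcm.2]
    have hvi := intervalIntegrable_lift hv
    have hui : IntervalIntegrable (fun x => (H (x + h / 2) - H x) / (h / 2)) volume 0 1 := by
      apply Continuous.intervalIntegrable
      have := hHc.continuous
      fun_prop
    have hgi' := hc'.intervalIntegrable (μ := volume) 0 1
    calc ∫ x in (0 : ℝ)..1, |v (x : UnitAddCircle) - (H (x + h / 2) - H x) / (h / 2)|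
        ≤ ∫ x in (0 : ℝ)..1, (|v (x : UnitAddCircle) - g' x| + e / 2) := by
          refine intervalIntegral.integral_mono_on zero_le_one (hvi.sub hui).abs
            ((hvi.sub hgi').abs.add intervalIntegrable_const) fun x _ => ?_
          exact (abs_sub_le _ (g' x) _).trans (by linarith [hclose x])
      _ = (∫ x in (0 : ℝ)..1, |v (x : UnitAddCircle) - g' x|) + e / 2 := by
          rw [intervalIntegral.integral_add (hvi.sub hgi').abs intervalIntegrable_const]
          simp
      _ ≤ e := by
          have h1 := UnitAddCircle.intervalIntegral_preimage 0 fun x => |v x - g x|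
          rw [zero_add] at h1
          simp only [Real.norm_eq_abs] at hg
          linarith

namespace InverseLift

variable {G : ℝ → ℝ} {d : ℕ} {θ D : ℝ} (hG : InverseLift G d θ D)
include hG

/-- The invariant density is the uniform limit of the iterates of the constant `1`. -/
theorem exists_density :
    ∃ ρ : ℝ → ℝ, InCone (coneWidth θ D) 1 ρ ∧ (∀ x, branchSum G d 1 ρ x = ρ x) ∧
      (∃ C, ∀ n x, |(branchSum G d 1)^[n] (fun _ => 1) x - ρ x| ≤ C * couplingRate θ D ^ n) ∧
      ∃ C, ∀ n x, |(branchSum G d 1)^[n + 1] (fun _ => 1) x - (branchSum G d 1)^[n] (fun _ => 1) x|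
        ≤ C * couplingRate θ D ^ n := by
  have ha := hG.coneWidth_pos
  have hq0 := hG.couplingRate_nonneg
  have hq := hG.couplingRate_lt_one
  have h1 : InCone (coneWidth θ D) 1 fun _ => (1 : ℝ) := InCone.const zero_le_one ha.le
  have hinc : ∀ n x, |(branchSum G d 1)^[n + 1] (fun _ => 1) x
      - (branchSum G d 1)^[n] (fun _ => 1) x|
        ≤ Real.exp (coneWidth θ D) * couplingRate θ D ^ n := by
    intro n x
    obtain ⟨f, g, hf, hg, h⟩ := hG.exists_coupling (hG.inCone_map_self h1) h1 n
    rw [Function.iterate_succ_apply, ← iterate_branchSum_sub, h x, abs_le]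
    have e1 := hf.le ha.le x
    have e2 := hg.le ha.le x
    have e3 := hf.nonneg x
    have e4 := hg.nonneg x
    constructor <;> linarith
  obtain ⟨ρ, hρ, hlim⟩ := exists_limit_of_geometric (w := fun n => (branchSum G d 1)^[n] fun _ => 1)
    hq hinc
  have hcone := hG.inCone_iterate h1
  have hconv : ∀ n x, |(branchSum G d 1)^[n] (fun _ => 1) x - ρ x|
      ≤ Real.exp (coneWidth θ D) / (1 - couplingRate θ D) * couplingRate θ D ^ n := fun n x =>
    (hρ n x).trans_eq (by ring)
  have hunif := tendstoUniformly_of_geometric hq0 hq hconv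
  have hcont : Continuous ρ :=
    hunif.continuous (Eventually.of_forall fun n => (hcone n).continuous).frequently
  refine ⟨ρ, ⟨hcont, fun x => ?_, fun x => ?_, fun x y => ?_, ?_⟩, fun x => ?_, ⟨_, hconv⟩,
    ⟨_, hinc⟩⟩
  · refine tendsto_nhds_unique (hlim (x + 1)) ?_
    simpa only [(hcone _).periodic x] using hlim x
  · exact ge_of_tendsto' (hlim x) fun n => (hcone n).nonneg x
  · exact le_of_tendsto_of_tendsto' (hlim x) ((hlim y).const_mul _) fun n => (hcone n).logLip x y
  · have hd : ∀ n, |1 - ∫ x in (0 : ℝ)..1, ρ x|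
        ≤ Real.exp (coneWidth θ D) / (1 - couplingRate θ D) * couplingRate θ D ^ n := by
      intro n
      have hsub := intervalIntegral.integral_sub ((hcone n).intervalIntegrable 0 1)
        (hcont.intervalIntegrable (μ := volume) 0 1)
      rw [(hcone n).integral] at hsub
      rw [← hsub]
      have := intervalIntegral.norm_integral_le_of_norm_le_const (a := 0) (b := 1)
        (f := fun x => (branchSum G d 1)^[n] (fun _ => 1) x - ρ x) (fun x _ => hconv n x)
      simpa using this
    have hz : |1 - ∫ x in (0 : ℝ)..1, ρ x| ≤ 0 := by
      refine ge_of_tendsto' (x := atTop) ?_ hd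
      simpa using (tendsto_pow_atTop_nhds_zero_of_lt_one hq0 hq).const_mul
        (Real.exp (coneWidth θ D) / (1 - couplingRate θ D))
    have := abs_eq_zero.1 (le_antisymm hz (abs_nonneg _))
    linarith
  · refine tendsto_nhds_unique (tendsto_branchSum hlim x) ?_
    simpa only [Function.iterate_succ_apply'] using (tendsto_add_atTop_iff_nat 1).2 (hlim x)

/-- An integrable fixed point of the transfer operator with integral `1` is the invariant density
almost everywhere: the operator does not increase the `L^1` distance between that fixed point and
the iterates of a smooth approximation, and these iterates converge to the invariant density. -/
theorem integral_abs_sub_eq_zero {ρ : ℝ → ℝ} (hρ : InCone (coneWidth θ D) 1 ρ)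
    {C : ℝ} (hC : ∀ n x, |(branchSum G d 1)^[n] (fun _ => 1) x - ρ x| ≤ C * couplingRate θ D ^ n)
    {v : UnitAddCircle → ℝ} (hv : Integrable v volume) (hv1 : ∫ x, v x = 1)
    (hfix : ∀ᵐ x : ℝ ∂volume.restrict (Set.Ioc 0 1),
      branchSum G d 1 (fun t => v (t : UnitAddCircle)) x = v (x : UnitAddCircle)) :
    ∫ x in (0 : ℝ)..1, |v (x : UnitAddCircle) - ρ x| = 0 := by
  have ha := hG.coneWidth_pos
  have hq0 := hG.couplingRate_nonneg
  have hq := hG.couplingRate_lt_one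
  set v' : ℝ → ℝ := fun t => v (t : UnitAddCircle) with hv'
  have hvp : Function.Periodic v' 1 := fun x => by
    simp only [hv', AddCircle.coe_add, AddCircle.coe_period, add_zero]
  have hvi : IntervalIntegrable v' volume 0 1 := intervalIntegrable_lift hv
  have hv1' : ∫ x in (0 : ℝ)..1, v' x = 1 := by
    have := UnitAddCircle.intervalIntegral_preimage 0 v
    rw [zero_add] at this
    exact this.trans hv1
  have hnn : 0 ≤ ∫ x in (0 : ℝ)..1, |v' x - ρ x| :=
    intervalIntegral.integral_nonneg zero_le_one fun _ _ => abs_nonneg _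
  refine le_antisymm (le_of_forall_pos_le_add fun e he => ?_) hnn
  rw [zero_add]
  have hE := Real.exp_pos (coneWidth θ D)
  set e' := e / (1 + Real.exp (coneWidth θ D)) with hedef
  have he' : 0 < e' := by positivity
  obtain ⟨u, huc, hup, hue⟩ := exists_contDiff_integral_abs_sub_le hv he'
  change ∫ x in (0 : ℝ)..1, |v' x - u x| ≤ e' at hue
  obtain ⟨M, hM0, hM⟩ := exists_abs_le_of_periodic hup huc.continuous
  obtain ⟨l, hl0, hl⟩ := exists_lipschitz_of_periodic hup huc
  have hui := huc.continuous.intervalIntegrable (μ := volume) 0 1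
  set m := ∫ x in (0 : ℝ)..1, u x with hm
  have hm1 : |1 - m| ≤ e' := by
    rw [← hv1', hm, ← intervalIntegral.integral_sub hvi hui]
    exact (intervalIntegral.abs_integral_le_integral_abs zero_le_one).trans hue
  -- the iterates of `u` stay as close to `v` as `u` is
  have hit : ∀ n, Function.Periodic ((branchSum G d 1)^[n] u) 1 ∧
      Continuous ((branchSum G d 1)^[n] u) ∧
      ∫ x in (0 : ℝ)..1, |v' x - (branchSum G d 1)^[n] u x| ≤ e' := by
    intro n
    induction n with
    | zero => exact ⟨hup, huc.continuous, hue⟩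
    | succ n ih =>
      obtain ⟨h1, h2, h3⟩ := ih
      rw [Function.iterate_succ_apply']
      refine ⟨hG.periodic h1 1, hG.continuous_branchSum h2 1, ?_⟩
      have h4 := hG.integral_abs_branchSum_le (w := fun t => v' t - (branchSum G d 1)^[n] u t)
        (fun x => by simp only [hvp x, h1 x]) (hvi.sub (h2.intervalIntegrable 0 1))
      refine le_trans (le_of_eq ?_) (h4.trans h3)
      rw [intervalIntegral.integral_of_le zero_le_one, intervalIntegral.integral_of_le zero_le_one]
      refine integral_congr_ae ?_
      filter_upwards [hfix] with x hx
      simp only [branchSum_sub, hx]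
      rfl
  obtain ⟨K, hK⟩ : ∃ K, ∀ n x, |(branchSum G d 1)^[n] u x - ρ x|
      ≤ K * couplingRate θ D ^ n + |1 - m| * Real.exp (coneWidth θ D) := by
    refine ⟨Real.exp (coneWidth θ D) * (M + |m| + l / coneWidth θ D) + |m| * C, fun n x => ?_⟩
    have hdec := hG.abs_iterate_le (w := fun t => u t - m * 1) (M := M + |m|) (l := l)
      (fun x => by simp only [hup x]) (huc.continuous.sub continuous_const) hl0.le
      (fun x => (abs_sub _ _).trans (by simpa using hM x)) (fun x y => by simpa using hl x y)
      (by rw [intervalIntegral.integral_sub hui intervalIntegrable_const]; simp [hm]) n x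
    rw [iterate_branchSum_sub, iterate_branchSum_const_mul] at hdec
    have h1 := mul_le_mul_of_nonneg_left (hC n x) (abs_nonneg m)
    rw [← abs_mul] at h1
    have h2 : |(1 - m) * ρ x| ≤ |1 - m| * Real.exp (coneWidth θ D) := by
      rw [abs_mul]
      refine mul_le_mul_of_nonneg_left ?_ (abs_nonneg _)
      rw [abs_of_nonneg (hρ.nonneg x)]
      simpa using hρ.le ha.le x
    have e1 := abs_le.1 hdec
    have e2 := abs_le.1 h1
    have e3 := abs_le.1 h2
    rw [abs_le]
    constructor <;> nlinarith
  have hfin : ∀ n, ∫ x in (0 : ℝ)..1, |v' x - ρ x|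
      ≤ e' + (K * couplingRate θ D ^ n + |1 - m| * Real.exp (coneWidth θ D)) := by
    intro n
    obtain ⟨-, h2, h3⟩ := hit n
    have hi := (hvi.sub (h2.intervalIntegrable (μ := volume) 0 1)).abs
    calc ∫ x in (0 : ℝ)..1, |v' x - ρ x|
        ≤ ∫ x in (0 : ℝ)..1, (|v' x - (branchSum G d 1)^[n] u x|
            + (K * couplingRate θ D ^ n + |1 - m| * Real.exp (coneWidth θ D))) :=
          intervalIntegral.integral_mono_on zero_le_one (hvi.sub (hρ.intervalIntegrable 0 1)).abs
            (hi.add intervalIntegrable_const)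
            fun x _ => (_root_.abs_sub_le _ ((branchSum G d 1)^[n] u x) _).trans
              (add_le_add le_rfl (hK n x))
      _ = (∫ x in (0 : ℝ)..1, |v' x - (branchSum G d 1)^[n] u x|)
            + (K * couplingRate θ D ^ n + |1 - m| * Real.exp (coneWidth θ D)) := by
          rw [intervalIntegral.integral_add hi intervalIntegrable_const]
          simp
      _ ≤ _ := by linarith
  have hlim : Tendsto (fun n : ℕ => e' + (K * couplingRate θ D ^ n
      + |1 - m| * Real.exp (coneWidth θ D))) atTop
      (𝓝 (e' + (K * 0 + |1 - m| * Real.exp (coneWidth θ D)))) :=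
    (((tendsto_pow_atTop_nhds_zero_of_lt_one hq0 hq).const_mul K).add_const _).const_add _
  refine (ge_of_tendsto' hlim hfin).trans ?_
  have h1 : e' * (1 + Real.exp (coneWidth θ D)) = e := by rw [hedef]; field_simp
  nlinarith

end InverseLift

/-! ### Regularity of the invariant density -/

/-- The lower order term in the derivative of `branchSum G d s w`, in which the derivative falls on
the weight. -/
noncomputable def branchSumDeriv (G : ℝ → ℝ) (d s : ℕ) (w : ℝ → ℝ) (x : ℝ) : ℝ :=
  ∑ j ∈ Finset.range d, w (G (x + j)) * deriv (fun y => deriv G y ^ s) (x + j)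

theorem contDiff_deriv_of_succ {f : ℝ → ℝ} {m : ℕ} (hf : ContDiff ℝ (m + 1 : ℕ) f) :
    ContDiff ℝ m (deriv f) := by
  rw [Nat.cast_add, Nat.cast_one, contDiff_succ_iff_deriv] at hf
  exact hf.2.2

theorem contDiff_succ_of_deriv {f : ℝ → ℝ} {m : ℕ} (hf : Differentiable ℝ f)
    (h : ContDiff ℝ m (deriv f)) : ContDiff ℝ (m + 1 : ℕ) f := by
  rw [Nat.cast_add, Nat.cast_one, contDiff_succ_iff_deriv]
  exact ⟨hf, fun h => absurd h (by simp), h⟩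

theorem contDiff_branchSum {G w : ℝ → ℝ} {d s m : ℕ} (hG : ContDiff ℝ (m + 1 : ℕ) G)
    (hw : ContDiff ℝ m w) : ContDiff ℝ m (branchSum G d s w) := by
  have h1 := contDiff_deriv_of_succ hG
  have h2 : ContDiff ℝ m G := hG.of_le (by exact_mod_cast Nat.le_succ m)
  unfold branchSum
  fun_prop

theorem contDiff_branchSumDeriv {G w : ℝ → ℝ} {d s m : ℕ} (hG : ContDiff ℝ (m + 2 : ℕ) G)
    (hw : ContDiff ℝ m w) : ContDiff ℝ m (branchSumDeriv G d s w) := by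
  have h1 : ContDiff ℝ m (deriv fun y => deriv G y ^ s) :=
    contDiff_deriv_of_succ ((contDiff_deriv_of_succ (m := m + 1) hG).pow s)
  have h2 : ContDiff ℝ m G := hG.of_le (by exact_mod_cast Nat.le_add_right m 2)
  unfold branchSumDeriv
  fun_prop

theorem hasDerivAt_branchSum {G w : ℝ → ℝ} {d : ℕ} (s : ℕ) (hG : ContDiff ℝ 2 G)
    (hw : Differentiable ℝ w) (x : ℝ) :
    HasDerivAt (branchSum G d s w)
      (branchSum G d (s + 1) (deriv w) x + branchSumDeriv G d s w x) x := by
  have hG' : ContDiff ℝ 1 (deriv G) := contDiff_deriv_of_succ (m := 1) hG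
  have hs : Differentiable ℝ fun y => deriv G y ^ s := (hG'.pow s).differentiable one_ne_zero
  rw [branchSum, branchSumDeriv, ← Finset.sum_add_distrib]
  unfold branchSum
  refine HasDerivAt.fun_sum fun j _ => ?_
  have h1 : HasDerivAt (fun y : ℝ => y + (j : ℝ)) 1 x := (hasDerivAt_id x).add_const _
  have h2 : HasDerivAt (fun y => G (y + j)) (deriv G (x + j) * 1) x :=
    ((hG.differentiable two_ne_zero) (x + j)).hasDerivAt.comp x h1
  have h3 : HasDerivAt (fun y => w (G (y + j))) _ x := (hw (G (x + j))).hasDerivAt.comp x h2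
  have h4 : HasDerivAt (fun y => deriv G (y + j) ^ s) _ x :=
    (hs (x + j)).hasDerivAt.comp_add_const x (j : ℝ)
  refine (h3.mul h4).congr_deriv ?_
  ring

namespace InverseLift

variable {G : ℝ → ℝ} {d : ℕ} {θ D : ℝ} (hG : InverseLift G d θ D)
include hG

theorem periodic_branchSumDeriv {w : ℝ → ℝ} (hw : Function.Periodic w 1) (s : ℕ) :
    Function.Periodic (branchSumDeriv G d s w) 1 := by
  have h1 : Function.Periodic (fun y => deriv G y ^ s) d := fun x => by
    simp only [hG.deriv_periodic x]
  have h2 := periodic_deriv h1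
  have h3 : Function.Periodic (fun x => w (G x) * deriv (fun y => deriv G y ^ s) x) d := fun x => by
    simp only [hG.add_degree, hw (G x), h2 x]
  exact periodic_sum_range h3

/-- If the approximations `w n` generated by `w ↦ branchSum G d s w + g` converge geometrically,
then so do their derivatives, because differentiation brings in one more contracting power of the
weight; hence the limit is `C^1`. -/
theorem contDiff_one_of_iterates (hG2 : ContDiff ℝ 2 G) {ρ : ℝ → ℝ} {a : ℝ} (ha : 0 ≤ a)
    (hρ : InCone a 1 ρ) (hρG : ∀ x, branchSum G d 1 ρ x = ρ x) {s : ℕ} (hs : 1 ≤ s) {g : ℝ → ℝ}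
    (hg : ContDiff ℝ 1 g) {w : ℕ → ℝ → ℝ} {v : ℝ → ℝ} (hwp : ∀ n, Function.Periodic (w n) 1)
    (hw : ∀ n, ContDiff ℝ 1 (w n)) (hrec : ∀ n x, w (n + 1) x = branchSum G d s (w n) x + g x)
    {K q₀ : ℝ} (hq0 : 0 ≤ q₀) (hq1 : q₀ < 1) (hK : ∀ n x, |w (n + 1) x - w n x| ≤ K * q₀ ^ n)
    (hlim : ∀ x, Tendsto (fun n => w n x) atTop (𝓝 (v x))) :
    ContDiff ℝ 1 v ∧
      ∀ x, deriv v x = branchSum G d (s + 1) (deriv v) x + (branchSumDeriv G d s v x + deriv g x) := by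
  have hθ0 := hG.theta_pos
  have hθ1 := hG.lt_one
  have hK0 : 0 ≤ K := by simpa using (abs_nonneg _).trans (hK 0 0)
  have hdiff : ∀ n, Differentiable ℝ (w n) := fun n => (hw n).differentiable one_ne_zero
  have hgd : Differentiable ℝ g := hg.differentiable one_ne_zero
  have hder : ∀ n x, deriv (w (n + 1)) x = branchSum G d (s + 1) (deriv (w n)) x
      + (branchSumDeriv G d s (w n) x + deriv g x) := by
    intro n x
    rw [show w (n + 1) = fun x => branchSum G d s (w n) x + g x from funext (hrec n)]
    rw [((hasDerivAt_branchSum s hG2 (hdiff n) x).fun_add (hgd x).hasDerivAt).deriv, add_assoc]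
  -- the norm is the supremum of `|f| / ρ`, which is finite because `c ≤ ρ`
  set c := Real.exp (-a) with hc
  have hc0 : 0 < c := Real.exp_pos _
  have hρc : ∀ x, c ≤ ρ x := fun x => by simpa using hρ.ge ha x
  -- bound for the lower order term
  obtain ⟨B, hB0, hB⟩ : ∃ B, 0 ≤ B ∧ ∀ (f : ℝ → ℝ) (L : ℝ), (∀ x, |f x| ≤ L) → ∀ x,
      |branchSumDeriv G d s f x| ≤ B * L := by
    have hcd : Continuous (deriv fun y => deriv G y ^ s) :=
      (contDiff_deriv_of_succ (m := 0)
        ((contDiff_deriv_of_succ (m := 1) hG2).pow s)).continuous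
    have h2 : Function.Periodic (fun x => ∑ j ∈ Finset.range d,
        |deriv (fun y => deriv G y ^ s) (x + j)|) 1 := by
      have h1 : Function.Periodic (fun y => deriv G y ^ s) d := fun x => by
        simp only [hG.deriv_periodic x]
      have h2 := periodic_deriv h1
      exact periodic_sum_range (h := fun x => |deriv (fun y => deriv G y ^ s) x|)
        fun x => by simp only [h2 x]
    obtain ⟨B, hB0, hB⟩ := exists_abs_le_of_periodic h2 (by fun_prop)
    refine ⟨B, hB0.le, fun f L hf x => ?_⟩
    have hL : 0 ≤ L := (abs_nonneg _).trans (hf 0)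
    calc |branchSumDeriv G d s f x|
        ≤ ∑ j ∈ Finset.range d, |f (G (x + j)) * deriv (fun y => deriv G y ^ s) (x + j)| :=
          Finset.abs_sum_le_sum_abs _ _
      _ ≤ ∑ j ∈ Finset.range d, L * |deriv (fun y => deriv G y ^ s) (x + j)| :=
          Finset.sum_le_sum fun j _ => by
            rw [abs_mul]; exact mul_le_mul_of_nonneg_right (hf _) (abs_nonneg _)
      _ = L * ∑ j ∈ Finset.range d, |deriv (fun y => deriv G y ^ s) (x + j)| := by
          rw [Finset.mul_sum]
      _ ≤ L * B := mul_le_mul_of_nonneg_left ((le_abs_self _).trans (hB x)) hL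
      _ = B * L := mul_comm _ _
  set q := max q₀ ((1 + θ) / 2) with hq
  have hqθ : θ < q := lt_of_lt_of_le (by linarith) (le_max_right _ _)
  have hqp : 0 < q := hθ0.trans hqθ
  have hq1' : q < 1 := max_lt hq1 (by linarith)
  obtain ⟨M, hM0, hM⟩ := exists_abs_le_of_periodic (f := fun x => deriv (w 1) x - deriv (w 0) x)
    (fun x => by simp only [periodic_deriv (hwp 1) x, periodic_deriv (hwp 0) x])
    (((hw 1).continuous_deriv le_rfl).sub ((hw 0).continuous_deriv le_rfl))
  set K' := max (M / c) (B * K / c / (q - θ)) with hK'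
  have hK'0 : 0 ≤ K' := le_max_of_le_left (by positivity)
  have hK'1 : θ * K' + B * K / c ≤ K' * q := by
    have h1 : B * K / c / (q - θ) ≤ K' := le_max_right _ _
    rw [div_le_iff₀ (by linarith)] at h1
    linarith
  have hinc : ∀ n x, |deriv (w (n + 1)) x - deriv (w n) x| ≤ K' * q ^ n * ρ x := by
    intro n
    induction n with
    | zero =>
      intro x
      refine (hM x).trans ?_
      have h1 : M ≤ K' * c := (div_le_iff₀ hc0).1 (le_max_left _ _)
      have h2 := mul_le_mul_of_nonneg_left (hρc x) hK'0
      simp only [pow_zero, mul_one]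
      linarith
    | succ n ih =>
      intro x
      have e : deriv (w (n + 1 + 1)) x - deriv (w (n + 1)) x
          = branchSum G d (s + 1) (fun t => deriv (w (n + 1)) t - deriv (w n) t) x
            + branchSumDeriv G d s (fun t => w (n + 1) t - w n t) x := by
        rw [hder (n + 1), hder n, branchSum_sub]
        have : branchSumDeriv G d s (fun t => w (n + 1) t - w n t) x
            = branchSumDeriv G d s (w (n + 1)) x - branchSumDeriv G d s (w n) x := by
          simp only [branchSumDeriv, sub_mul, Finset.sum_sub_distrib]
        rw [this]; ring
      have h1 : |branchSum G d (s + 1) (fun t => deriv (w (n + 1)) t - deriv (w n) t) x|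
          ≤ θ * (K' * q ^ n * ρ x) := by
        refine (hG.abs_branchSum_le _ _ x).trans ?_
        refine (hG.branchSum_mono ih x).trans ?_
        rw [add_comm s 1]
        have h2 := hG.branchSum_le_pow_mul (w := fun x => K' * q ^ n * ρ x)
          (fun x => mul_nonneg (mul_nonneg hK'0 (pow_nonneg hqp.le n)) (hρ.nonneg x)) 1 s x
        rw [branchSum_const_mul (s := 1), hρG] at h2
        refine h2.trans (mul_le_mul_of_nonneg_right ?_
          (mul_nonneg (mul_nonneg hK'0 (pow_nonneg hqp.le n)) (hρ.nonneg x)))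
        exact pow_le_of_le_one hθ0.le hθ1.le (by omega)
      have h2 : |branchSumDeriv G d s (fun t => w (n + 1) t - w n t) x|
          ≤ B * K / c * q ^ n * ρ x := by
        refine (hB _ (K * q₀ ^ n) (hK n) x).trans ?_
        have h3 : q₀ ^ n ≤ q ^ n := pow_le_pow_left₀ hq0 (le_max_left _ _) n
        have h4 : 0 ≤ B * K / c * q ^ n :=
          mul_nonneg (by positivity) (pow_nonneg hqp.le n)
        have h5 := mul_le_mul_of_nonneg_left (hρc x) h4
        have h6 : B * K / c * q ^ n * c = B * K * q ^ n := by field_simp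
        have h7 := mul_le_mul_of_nonneg_left h3 (mul_nonneg hB0 hK0)
        linarith
      rw [e]
      refine (abs_add_le _ _).trans ((add_le_add h1 h2).trans ?_)
      have h3 := mul_le_mul_of_nonneg_right hK'1 (mul_nonneg (pow_nonneg hqp.le n) (hρ.nonneg x))
      rw [pow_succ]
      linarith
  have hinc' : ∀ n x, |deriv (w (n + 1)) x - deriv (w n) x| ≤ K' * Real.exp a * q ^ n := by
    intro n x
    refine (hinc n x).trans ?_
    have h1 : ρ x ≤ Real.exp a := by simpa using hρ.le ha x
    have := mul_le_mul_of_nonneg_left h1 (mul_nonneg hK'0 (pow_nonneg hqp.le n))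
    linarith
  obtain ⟨v', hv', hlim'⟩ := exists_limit_of_geometric (w := fun n => deriv (w n))
    hq1' hinc'
  have hunif := tendstoUniformly_of_geometric (w := fun n => deriv (w n)) (v := v')
    (C := K' * Real.exp a / (1 - q)) hqp.le hq1' fun n x => (hv' n x).trans_eq (by ring)
  have hv : ∀ x, HasDerivAt v (v' x) x := hasDerivAt_of_tendstoUniformly hunif
    (Eventually.of_forall fun n x => (hdiff n x).hasDerivAt) hlim
  have hdv : deriv v = v' := funext fun x => (hv x).deriv
  have hcv : Continuous v' := hunif.continuous
    (Eventually.of_forall fun n => (hw n).continuous_deriv le_rfl).frequently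
  refine ⟨contDiff_one_iff_deriv.2 ⟨fun x => (hv x).differentiableAt, hdv ▸ hcv⟩, fun x => ?_⟩
  rw [hdv]
  refine tendsto_nhds_unique ((tendsto_add_atTop_iff_nat 1).2 (hlim' x)) ?_
  simp only [hder]
  refine (tendsto_branchSum hlim' x).add (Tendsto.add_const _ ?_)
  exact tendsto_finsetSum _ fun _ _ => (hlim _).mul_const _

theorem contDiff_one_of_fixed (hG2 : ContDiff ℝ 2 G) {ρ : ℝ → ℝ} {a : ℝ} (ha : 0 ≤ a)
    (hρ : InCone a 1 ρ) (hρG : ∀ x, branchSum G d 1 ρ x = ρ x) {s : ℕ} (hs : 2 ≤ s) {g v : ℝ → ℝ}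
    (hg : ContDiff ℝ 1 g) (hgp : Function.Periodic g 1) (hv : Continuous v)
    (hvp : Function.Periodic v 1) (hfix : ∀ x, v x = branchSum G d s v x + g x) :
    ContDiff ℝ 1 v ∧
      ∀ x, deriv v x = branchSum G d (s + 1) (deriv v) x + (branchSumDeriv G d s v x + deriv g x) := by
  have hθ0 := hG.theta_pos
  have hθ1 := hG.lt_one
  set w : ℕ → ℝ → ℝ := fun n => (fun f x => branchSum G d s f x + g x)^[n] fun _ => 0 with hw
  have hrec : ∀ n x, w (n + 1) x = branchSum G d s (w n) x + g x := fun n x => by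
    simp only [hw, Function.iterate_succ_apply']
  have hwp : ∀ n, Function.Periodic (w n) 1 ∧ ContDiff ℝ 1 (w n) := by
    intro n
    induction n with
    | zero => exact ⟨fun _ => rfl, contDiff_const⟩
    | succ n ih =>
      rw [show w (n + 1) = fun x => branchSum G d s (w n) x + g x from funext (hrec n)]
      exact ⟨fun x => by simp only [hG.periodic ih.1 s x, hgp x],
        (contDiff_branchSum (m := 1) hG2 ih.2).add hg⟩
  obtain ⟨M, hM0, hM⟩ := exists_abs_le_of_periodic hvp hv
  set c := Real.exp (-a) with hc
  have hc0 : 0 < c := Real.exp_pos _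
  have hρc : ∀ x, c ≤ ρ x := fun x => by simpa using hρ.ge ha x
  have hclose : ∀ n x, |w n x - v x| ≤ M / c * θ ^ n * ρ x := by
    intro n
    induction n with
    | zero =>
      intro x
      have h1 := mul_le_mul_of_nonneg_left (hρc x) (div_pos hM0 hc0).le
      rw [div_mul_cancel₀ _ hc0.ne'] at h1
      have h2 := hM x
      simp only [hw, Function.iterate_zero, id, zero_sub, abs_neg, pow_zero, mul_one]
      linarith
    | succ n ih =>
      intro x
      have e : w (n + 1) x - v x = branchSum G d s (fun t => w n t - v t) x := by
        rw [hrec, branchSum_sub, hfix x]; ring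
      have h0 : ∀ x, 0 ≤ M / c * θ ^ n * ρ x := fun x => by
        have := hρ.nonneg x
        positivity
      obtain ⟨r, rfl⟩ := Nat.exists_eq_add_of_le (show 1 ≤ s by omega)
      rw [e]
      refine (hG.abs_branchSum_le _ _ x).trans ((hG.branchSum_mono ih x).trans ?_)
      have h2 := hG.branchSum_le_pow_mul h0 1 r x
      rw [branchSum_const_mul (s := 1), hρG] at h2
      refine h2.trans ?_
      have h3 : θ ^ r ≤ θ := pow_le_of_le_one hθ0.le hθ1.le (by omega)
      refine (mul_le_mul_of_nonneg_right h3 (h0 x)).trans_eq ?_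
      rw [pow_succ]; ring
  have hclose' : ∀ n x, |w n x - v x| ≤ M / c * Real.exp a * θ ^ n := by
    intro n x
    refine (hclose n x).trans ?_
    have h1 : ρ x ≤ Real.exp a := by simpa using hρ.le ha x
    have h2 : 0 ≤ M / c * θ ^ n := by positivity
    have := mul_le_mul_of_nonneg_left h1 h2
    linarith
  have hinc : ∀ n x, |w (n + 1) x - w n x| ≤ 2 * (M / c * Real.exp a) * θ ^ n := by
    intro n x
    have h1 := abs_le.1 (hclose' n x)
    have h2 := abs_le.1 (hclose' (n + 1) x)
    have h3 : θ ^ (n + 1) ≤ θ ^ n := pow_le_pow_of_le_one hθ0.le hθ1.le (Nat.le_succ n)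
    have h4 : 0 ≤ M / c * Real.exp a := by positivity
    have h5 := mul_le_mul_of_nonneg_left h3 h4
    rw [abs_le]
    constructor <;> linarith
  exact hG.contDiff_one_of_iterates hG2 ha hρ hρG (by omega) hg (fun n => (hwp n).1)
    (fun n => (hwp n).2) hrec hθ0.le hθ1 hinc
    fun x => (tendstoUniformly_of_geometric hθ0.le hθ1 hclose').tendsto_at x

theorem contDiff_of_fixed {ρ : ℝ → ℝ} {a : ℝ} (ha : 0 ≤ a)
    (hρ : InCone a 1 ρ) (hρG : ∀ x, branchSum G d 1 ρ x = ρ x) (m : ℕ) :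
    ContDiff ℝ (m + 1 : ℕ) G → ∀ {s : ℕ} (_ : 2 ≤ s) {g v : ℝ → ℝ}
    (_ : ContDiff ℝ m g) (_ : Function.Periodic g 1) (_ : Continuous v)
    (_ : Function.Periodic v 1) (_ : ∀ x, v x = branchSum G d s v x + g x), ContDiff ℝ m v := by
  induction m with
  | zero => intro _ s _ g v _ _ hv _ _; exact contDiff_zero.2 hv
  | succ m ih =>
    intro hGm s hs g v hg hgp hv hvp hfix
    have hm : ContDiff ℝ m v := ih (hGm.of_le (by exact_mod_cast Nat.le_succ _)) hs
      (hg.of_le (by exact_mod_cast Nat.le_succ _)) hgp hv hvp hfix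
    obtain ⟨h1, h2⟩ := hG.contDiff_one_of_fixed
      (hGm.of_le (by exact_mod_cast (by omega : 2 ≤ m + 1 + 1))) ha hρ hρG hs
      (hg.of_le (by exact_mod_cast (by omega : 1 ≤ m + 1))) hgp hv hvp hfix
    refine contDiff_succ_of_deriv (h1.differentiable one_ne_zero) ?_
    exact ih (hGm.of_le (by exact_mod_cast Nat.le_succ _)) (s := s + 1) (by omega)
      ((contDiff_branchSumDeriv hGm hm).add (contDiff_deriv_of_succ hg))
      (fun x => by simp only [hG.periodic_branchSumDeriv hvp s x, periodic_deriv hgp x])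
      (h1.continuous_deriv le_rfl) (periodic_deriv hvp) h2

/-- The invariant density of a map of class `C^(m+1)` is of class `C^m`. -/
theorem contDiff_density {ρ : ℝ → ℝ} {a : ℝ} (ha : 0 ≤ a)
    (hρ : InCone a 1 ρ) (hρG : ∀ x, branchSum G d 1 ρ x = ρ x)
    {C : ℝ} (hC : ∀ n x, |(branchSum G d 1)^[n] (fun _ => 1) x - ρ x| ≤ C * couplingRate θ D ^ n)
    {C' : ℝ} (hC' : ∀ n x, |(branchSum G d 1)^[n + 1] (fun _ => 1) x
      - (branchSum G d 1)^[n] (fun _ => 1) x| ≤ C' * couplingRate θ D ^ n) (m : ℕ)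
    (hGm : ContDiff ℝ (m + 1 : ℕ) G) : ContDiff ℝ m ρ := by
  induction m with
  | zero => exact contDiff_zero.2 hρ.continuous
  | succ m ih =>
    have hm := ih (hGm.of_le (by exact_mod_cast Nat.le_succ _))
    have hG2 : ContDiff ℝ 2 G := hGm.of_le (by exact_mod_cast (by omega : 2 ≤ m + 1 + 1))
    have hwp : ∀ n, Function.Periodic ((branchSum G d 1)^[n] fun _ => 1) 1 ∧
        ContDiff ℝ 1 ((branchSum G d 1)^[n] fun _ => 1) := by
      intro n
      induction n with
      | zero => exact ⟨fun _ => rfl, contDiff_const⟩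
      | succ n ih =>
        rw [Function.iterate_succ_apply']
        exact ⟨hG.periodic ih.1 1, contDiff_branchSum (m := 1) hG2 ih.2⟩
    obtain ⟨h1, h2⟩ := hG.contDiff_one_of_iterates hG2 ha hρ hρG le_rfl (g := fun _ => 0)
      contDiff_const (w := fun n => (branchSum G d 1)^[n] fun _ => 1) (v := ρ)
      (fun n => (hwp n).1) (fun n => (hwp n).2)
      (fun n x => by simp only [Function.iterate_succ_apply', add_zero]) hG.couplingRate_nonneg
      hG.couplingRate_lt_one hC'
      fun x => (tendstoUniformly_of_geometric hG.couplingRate_nonneg hG.couplingRate_lt_one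
        hC).tendsto_at x
    refine contDiff_succ_of_deriv (h1.differentiable one_ne_zero) ?_
    refine hG.contDiff_of_fixed ha hρ hρG m (hGm.of_le (by exact_mod_cast Nat.le_succ _))
      (s := 1 + 1) le_rfl (g := fun x => branchSumDeriv G d 1 ρ x)
      (contDiff_branchSumDeriv hGm hm) (hG.periodic_branchSumDeriv hρ.periodic 1)
      (h1.continuous_deriv le_rfl) (periodic_deriv hρ.periodic) fun x => ?_
    simpa using h2 x

end InverseLift

/-! ### Lifts of expanding circle maps -/

/-- `F` is a lift of class `C^k` and degree `d` of an expanding circle map, and `G` its inverse. -/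
structure LiftPair (k d : ℕ) (F G : ℝ → ℝ) : Prop where
  contDiff : ContDiff ℝ k F
  contDiff_inv : ContDiff ℝ k G
  add_one : ∀ t, F (t + 1) = F t + d
  left_inv : ∀ t, G (F t) = t
  right_inv : ∀ x, F (G x) = x
  one_lt : ∀ t, 1 < deriv F t

theorem exists_liftPair {k d : ℕ} (hk : 1 ≤ k) {F : ℝ → ℝ} (hF : ContDiff ℝ k F)
    (hd : ∀ t, F (t + 1) = F t + d) (h1 : ∀ t, 1 < deriv F t) : ∃ G, LiftPair k d F G := by
  have hk' : (k : WithTop ℕ∞) ≠ 0 := by exact_mod_cast (by omega : k ≠ 0)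
  have hdiff := hF.differentiable hk'
  have hmono : StrictMono fun t => F t - t := strictMono_of_deriv_pos fun t => by
    have h2 : HasDerivAt (fun t => F t - t) (deriv F t - 1) t :=
      (hdiff t).hasDerivAt.fun_sub (hasDerivAt_id t)
    rw [h2.deriv]; linarith [h1 t]
  have hFm : StrictMono F := strictMono_of_deriv_pos fun t => by linarith [h1 t]
  have hsurj : Function.Surjective F := by
    refine hF.continuous.surjective ?_ ?_
    · refine tendsto_atTop_mono' _ ?_ (tendsto_atTop_add_const_left atTop (F 0) tendsto_id)
      filter_upwards [eventually_ge_atTop 0] with t ht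
      have := hmono.monotone ht
      simp only [id]
      linarith
    · refine tendsto_atBot_mono' _ ?_ (tendsto_atBot_add_const_left atBot (F 0) tendsto_id)
      filter_upwards [eventually_le_atBot 0] with t ht
      have := hmono.monotone ht
      simp only [id]
      linarith
  set e := hFm.orderIsoOfSurjective F hsurj with he
  have hGF : ContDiff ℝ k e.toHomeomorph.symm :=
    Homeomorph.contDiff_symm_deriv e.toHomeomorph (f' := deriv F)
      (fun t => by linarith [h1 t]) (fun t => (hdiff t).hasDerivAt) hF
  exact ⟨e.symm, hF, hGF, hd, fun t => e.symm_apply_apply t, fun x => e.apply_symm_apply x, h1⟩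

theorem coe_eq_coe_iff {s t : ℝ} : (s : UnitAddCircle) = t ↔ ∃ n : ℤ, s = t + n := by
  rw [← sub_eq_zero, ← AddCircle.coe_sub, AddCircle.coe_eq_zero_iff]
  constructor
  · rintro ⟨n, hn⟩
    exact ⟨n, by simp at hn; linarith⟩
  · rintro ⟨n, hn⟩
    exact ⟨n, by simp; linarith⟩

theorem coe_add_one (t : ℝ) : ((t + 1 : ℝ) : UnitAddCircle) = t := by
  rw [AddCircle.coe_add, AddCircle.coe_period, add_zero]

theorem periodic_lift (w : UnitAddCircle → ℝ) :
    Function.Periodic (fun t : ℝ => w (t : UnitAddCircle)) 1 := fun t => by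
  simp only [coe_add_one]

theorem circleDeriv_eq_deriv {T : UnitAddCircle → UnitAddCircle} {F : ℝ → ℝ}
    (hF : Differentiable ℝ F)
    (hT : ∀ t : ℝ, ((F t : ℝ) : UnitAddCircle) = T (t : UnitAddCircle)) (s : ℝ) :
    circleDeriv T (s : UnitAddCircle) = deriv F s := by
  have hev : (fun t : ℝ => rep (T ((s : UnitAddCircle) + (t : UnitAddCircle))
      - T (s : UnitAddCircle))) =ᶠ[𝓝 0] fun t => F (s + t) - F s := by
    have hc : ContinuousAt (fun t => F (s + t) - F s) 0 := by
      have := hF.continuous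
      fun_prop
    have hmem : Set.Ioo (-1 / 2 : ℝ) (1 / 2) ∈ 𝓝 (F (s + 0) - F s) := by
      rw [add_zero, sub_self]
      exact Ioo_mem_nhds (by norm_num) (by norm_num)
    filter_upwards [hc.preimage_mem_nhds hmem] with t ht
    rw [← AddCircle.coe_add, ← hT, ← hT, ← AddCircle.coe_sub, rep,
      AddCircle.equivIoc_coe_eq (⟨ht.1, by linarith [ht.2]⟩ :
        F (s + t) - F s ∈ Set.Ioc (-1 / 2 : ℝ) (-1 / 2 + 1))]
  rw [circleDeriv, hev.deriv_eq, deriv_sub_const, deriv_comp_const_add, add_zero]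

/-- A lift of an expanding circle map has a degree. -/
theorem exists_degree {T : UnitAddCircle → UnitAddCircle} {F : ℝ → ℝ} (hF : Differentiable ℝ F)
    (hT : ∀ t : ℝ, ((F t : ℝ) : UnitAddCircle) = T (t : UnitAddCircle))
    (h1 : ∀ t, 1 < deriv F t) : ∃ d : ℕ, ∀ t, F (t + 1) = F t + d := by
  have hint : ∀ t, ∃ n : ℤ, F (t + 1) = F t + n := fun t => by
    rw [← coe_eq_coe_iff, hT, hT, coe_add_one]
  have hc : Continuous fun t => F (t + 1) - F t := by
    have := hF.continuous
    fun_prop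
  have hrange : Set.range (fun t => F (t + 1) - F t) ⊆ Set.range ((↑) : ℤ → ℝ) := by
    rintro _ ⟨t, rfl⟩
    obtain ⟨n, hn⟩ := hint t
    exact ⟨n, by simp only [hn]; ring⟩
  have hsub : (Set.range fun t => F (t + 1) - F t).Subsingleton :=
    ((Set.countable_range _).mono hrange).isTotallyDisconnected _ subset_rfl (isPreconnected_range hc)
  obtain ⟨n, hn⟩ := hint 0
  have hall : ∀ t, F (t + 1) = F t + n := fun t => by
    have : F (t + 1) - F t = F (0 + 1) - F 0 := hsub ⟨t, rfl⟩ ⟨0, rfl⟩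
    linarith
  have hmono : StrictMono F := strictMono_of_deriv_pos fun t => by linarith [h1 t]
  have hn0 : 0 ≤ n := by
    have h2 := hmono (show (0 : ℝ) < 0 + 1 by norm_num)
    have h3 : (0 : ℝ) < n := by linarith
    exact_mod_cast h3.le
  obtain ⟨d, rfl⟩ := Int.eq_ofNat_of_zero_le hn0
  exact ⟨d, fun t => by simpa using hall t⟩

namespace LiftPair

variable {k d : ℕ} {F G : ℝ → ℝ} (h : LiftPair k d F G)
include h

theorem of_le {l : ℕ} (hl : l ≤ k) : LiftPair l d F G :=
  { h with
    contDiff := h.contDiff.of_le (by exact_mod_cast hl)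
    contDiff_inv := h.contDiff_inv.of_le (by exact_mod_cast hl) }

theorem periodic_deriv : Function.Periodic (deriv F) 1 := fun t => by
  rw [← deriv_comp_add_const, show (fun t => F (t + 1)) = fun t => F t + d from
    funext h.add_one, deriv_add_const]

theorem add_int (t : ℝ) (m : ℤ) : F (t + m) = F t + d * m := by
  have hp : Function.Periodic (fun t => F t - d * t) 1 := fun t => by
    simp only [h.add_one]; ring
  have := hp.int_mul m t
  simp only [mul_one] at this
  linarith

theorem inv_add_int (x : ℝ) (m : ℤ) : G (x + d * m) = G x + m := by
  rw [← h.left_inv (G x + m), h.add_int, h.right_inv]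

theorem differentiable (hk : k ≠ 0) : Differentiable ℝ F :=
  h.contDiff.differentiable (by exact_mod_cast hk)

theorem differentiable_inv (hk : k ≠ 0) : Differentiable ℝ G :=
  h.contDiff_inv.differentiable (by exact_mod_cast hk)

theorem deriv_inv (hk : k ≠ 0) (x : ℝ) : deriv G x = (deriv F (G x))⁻¹ := by
  have h1 := (h.differentiable hk (G x)).hasDerivAt.comp x (h.differentiable_inv hk x).hasDerivAt
  have h2 : F ∘ G = id := funext h.right_inv
  rw [h2] at h1
  exact eq_inv_of_mul_eq_one_right (h1.unique (hasDerivAt_id x))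

theorem deriv_inv_apply (hk : k ≠ 0) (t : ℝ) : deriv G (F t) = (deriv F t)⁻¹ := by
  rw [h.deriv_inv hk, h.left_inv]

theorem degree_pos : 0 < d := by
  have hmono : StrictMono F := strictMono_of_deriv_pos fun t => by linarith [h.one_lt t]
  have h2 := hmono (show (0 : ℝ) < 0 + 1 by norm_num)
  rw [h.add_one] at h2
  exact_mod_cast (by linarith : (0 : ℝ) < d)

/-- Bounds on the first two derivatives of a lift give the constants of its inverse. -/
theorem inverseLift (hk : 2 ≤ k) {l D : ℝ} (hl : 1 < l) (hF : ∀ t, l ≤ deriv F t) (hD0 : 0 < D)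
    (hD : ∀ t, |deriv (deriv F) t| ≤ D) : InverseLift G d l⁻¹ D := by
  have hk0 : k ≠ 0 := by omega
  have hF0 : ∀ t, 0 < deriv F t := fun t => by linarith [hF t]
  have hle1 : ∀ x, |deriv G x| ≤ 1 := fun x => by
    rw [h.deriv_inv hk0, abs_of_pos (inv_pos.2 (hF0 _))]
    exact inv_le_one_of_one_le₀ (h.one_lt _).le
  refine ⟨h.contDiff_inv.of_le (by exact_mod_cast (by omega : 1 ≤ k)), fun x => ?_, fun x => ?_,
    fun x => ?_, inv_lt_one_of_one_lt₀ hl, hD0, fun x y => ?_⟩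
  · have := h.inv_add_int x 1
    simpa using this
  · rw [h.deriv_inv hk0]; exact inv_pos.2 (hF0 _)
  · rw [h.deriv_inv hk0]; exact inv_anti₀ (by linarith) (hF _)
  · have h1 : Differentiable ℝ (deriv F) :=
      (contDiff_deriv_of_succ (m := 1) (h.of_le hk).contDiff).differentiable one_ne_zero
    have h2 := (abs_le.1 (abs_sub_le_of_abs_deriv_le h1 hD (G y) (G x))).2
    have h3 := abs_sub_le_of_abs_deriv_le (h.differentiable_inv hk0) hle1 y x
    rw [one_mul, abs_sub_comm y x] at h3
    have h4 := mul_le_mul_of_nonneg_left h3 hD0.le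
    have h5 := Real.add_one_le_exp (D * |x - y|)
    have h6 := mul_le_mul_of_nonneg_right h5 (hF0 (G x)).le
    have h7 : 0 ≤ D * |x - y| := by positivity
    have h8 := mul_le_mul_of_nonneg_left (h.one_lt (G x)).le h7
    rw [h.deriv_inv hk0, h.deriv_inv hk0, ← div_eq_mul_inv, inv_eq_one_div,
      div_le_div_iff₀ (hF0 _) (hF0 _)]
    linarith

theorem exists_deriv_bounds (hk : 2 ≤ k) : ∃ l D : ℝ, 1 < l ∧ (∀ t, l ≤ deriv F t) ∧ 0 < D ∧
    ∀ t, |deriv (deriv F) t| ≤ D := by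
  have h1 : ContDiff ℝ 1 (deriv F) := contDiff_deriv_of_succ (m := 1) (h.of_le hk).contDiff
  obtain ⟨D, hD0, hD⟩ := exists_abs_le_of_periodic (CircleResponse.periodic_deriv h.periodic_deriv)
    (h1.continuous_deriv le_rfl)
  have hpos : ∀ t, 0 < deriv F t - 1 := fun t => by linarith [h.one_lt t]
  obtain ⟨M, hM0, hM⟩ := exists_abs_le_of_periodic (f := fun t => (deriv F t - 1)⁻¹)
    (fun t => by simp only [h.periodic_deriv t])
    ((h1.continuous.sub continuous_const).inv₀ fun t => (hpos t).ne')
  refine ⟨1 + M⁻¹, D, by linarith [inv_pos.2 hM0], fun t => ?_, hD0, hD⟩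
  have h2 := (le_abs_self _).trans (hM t)
  rw [inv_le_comm₀ (hpos t) hM0] at h2
  linarith

/-! ### The transfer operator on the circle -/

variable {T : UnitAddCircle → UnitAddCircle}
  (hT : ∀ t : ℝ, ((F t : ℝ) : UnitAddCircle) = T (t : UnitAddCircle))
include hT

theorem transfer_eq (hk : k ≠ 0) (w : UnitAddCircle → ℝ) (x : ℝ) :
    transfer T w (x : UnitAddCircle) = branchSum G d 1 (fun t => w (t : UnitAddCircle)) x := by
  have hd := h.degree_pos
  have hpre : T ⁻¹' {(x : UnitAddCircle)}
      = (fun j : ℕ => ((G (x + j) : ℝ) : UnitAddCircle)) '' (Finset.range d : Set ℕ) := by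
    ext y
    obtain ⟨s, rfl⟩ := QuotientAddGroup.mk_surjective y
    change T (s : UnitAddCircle) = x ↔ _
    rw [← hT, coe_eq_coe_iff]
    constructor
    · rintro ⟨n, hn⟩
      have hd' : (d : ℤ) ≠ 0 := by exact_mod_cast hd.ne'
      refine ⟨(n % d).toNat, ?_, ?_⟩
      · have h1 := Int.emod_lt_of_pos n (by exact_mod_cast hd : (0 : ℤ) < d)
        have h2 := Int.emod_nonneg n hd'
        simp only [Finset.coe_range, Set.mem_Iio]
        omega
      · have h2 : ((n % d).toNat : ℤ) = n % d := Int.toNat_of_nonneg (Int.emod_nonneg n hd')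
        have h3 : (((n % d).toNat : ℕ) : ℝ) = ((n % d : ℤ) : ℝ) := by exact_mod_cast h2
        have h4 : (n : ℝ) = ((n % d : ℤ) : ℝ) + d * ((n / d : ℤ) : ℝ) := by
          exact_mod_cast (Int.emod_add_mul_ediv n d).symm
        refine Eq.symm (coe_eq_coe_iff.2 ⟨n / d, ?_⟩)
        rw [h3, ← h.inv_add_int, ← h.left_inv s, hn, h4, add_assoc]
    · rintro ⟨j, -, hj⟩
      obtain ⟨n, hn⟩ := coe_eq_coe_iff.1 hj.symm
      refine ⟨j + d * n, ?_⟩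
      rw [hn, h.add_int, h.right_inv]
      push_cast; ring
  have hinj : Set.InjOn (fun j : ℕ => ((G (x + j) : ℝ) : UnitAddCircle))
      (Finset.range d : Set ℕ) := by
    intro i hi j hj hij
    simp only [Finset.coe_range, Set.mem_Iio] at hi hj
    obtain ⟨n, hn⟩ := coe_eq_coe_iff.1 hij
    rw [← h.inv_add_int] at hn
    have h1 := congrArg F hn
    rw [h.right_inv, h.right_inv, add_assoc, add_right_inj] at h1
    have h2 : (i : ℤ) = j + d * n := by exact_mod_cast h1
    have h3 : n = 0 := by
      by_contra h0
      rcases lt_or_gt_of_ne h0 with h0 | h0 <;> nlinarith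
    rw [h3] at h2
    omega
  rw [transfer, hpre, finsum_mem_image hinj, finsum_mem_coe_finset, branchSum]
  refine Finset.sum_congr rfl fun j _ => ?_
  rw [circleDeriv_eq_deriv (h.differentiable hk) hT, pow_one, h.deriv_inv hk, div_eq_mul_inv]

end LiftPair

theorem IsExpandingMap.exists_liftPair {k : ℕ} (hk : 1 ≤ k) {T : UnitAddCircle → UnitAddCircle}
    (hT : IsExpandingMap k T) : ∃ (d : ℕ) (F G : ℝ → ℝ), LiftPair k d F G ∧
      ∀ t : ℝ, ((F t : ℝ) : UnitAddCircle) = T (t : UnitAddCircle) := by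
  obtain ⟨F, hF, hFT, h1⟩ := hT
  obtain ⟨d, hd⟩ := exists_degree
    (hF.differentiable (by exact_mod_cast (by omega : k ≠ 0))) hFT h1
  obtain ⟨G, hG⟩ := CircleResponse.exists_liftPair hk hF hd h1
  exact ⟨d, F, G, hG, hFT⟩

theorem integral_circle_eq (f : UnitAddCircle → ℝ) :
    ∫ x, f x = ∫ t in (0 : ℝ)..1, f (t : UnitAddCircle) := by
  have := UnitAddCircle.intervalIntegral_preimage 0 f
  rw [zero_add] at this
  exact this.symm

theorem continuous_of_lift {w : UnitAddCircle → ℝ}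
    (hw : Continuous fun t : ℝ => w (t : UnitAddCircle)) : Continuous w :=
  continuous_coinduced_dom.2 hw

/-- An expanding map of class `C^(m+1)` has a positive invariant density of class `C^m`, which is
fixed by the transfer operator everywhere and unique among the integrable ones. -/
theorem exists_isUniqueInvariantDensity {m : ℕ} (hm : 2 ≤ m) {T : UnitAddCircle → UnitAddCircle}
    (hT : IsExpandingMap (m + 1) T) : ∃ w, IsUniqueInvariantDensity T w ∧ IsCk m w ∧
      (∀ x, transfer T w x = w x) ∧ ∀ x, 0 < w x := by
  obtain ⟨d, F, G, h, hFT⟩ := hT.exists_liftPair (by omega)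
  obtain ⟨l, D, hl, hF, hD0, hD⟩ := h.exists_deriv_bounds (by omega)
  have hG := h.inverseLift (by omega) hl hF hD0 hD
  have ha := hG.coneWidth_pos
  obtain ⟨ρ, hρ, hfix, ⟨C, hC⟩, ⟨C', hC'⟩⟩ := hG.exists_density
  have hsmooth := hG.contDiff_density ha.le hρ hfix hC hC' m h.contDiff_inv
  set w : UnitAddCircle → ℝ := hρ.periodic.lift with hw
  have hwρ : (fun t : ℝ => w (t : UnitAddCircle)) = ρ := funext fun t =>
    hρ.periodic.lift_coe t
  have hwρ' : ∀ t : ℝ, w (t : UnitAddCircle) = ρ t := fun t => congrFun hwρ t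
  have hwk : IsCk m w := by rw [IsCk, hwρ]; exact hsmooth
  have hpos : ∀ x, 0 < w x := fun x => by
    obtain ⟨t, rfl⟩ := QuotientAddGroup.mk_surjective x
    refine lt_of_lt_of_eq ?_ (hwρ' t).symm
    exact lt_of_lt_of_le (by positivity) (hρ.ge ha.le t)
  have htr : ∀ x, transfer T w x = w x := fun x => by
    obtain ⟨t, rfl⟩ := QuotientAddGroup.mk_surjective x
    refine (h.transfer_eq hFT (by omega) w t).trans ?_
    rw [hwρ, hfix]
    exact (hwρ' t).symm
  have hcont : Continuous w := continuous_of_lift (by rw [hwρ]; exact hρ.continuous)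
  have hint : Integrable w volume := hcont.integrable_of_hasCompactSupport
    (HasCompactSupport.of_compactSpace _)
  refine ⟨w, ⟨hwk.of_le (by exact_mod_cast hm), ⟨hint, ?_, ?_, ?_⟩, fun v hv => ?_⟩, hwk, htr, hpos⟩
  · exact Eventually.of_forall fun x => (hpos x).le
  · rw [integral_circle_eq, hwρ, hρ.integral]
  · exact Eventually.of_forall htr
  · have hae : ∀ᵐ x : ℝ ∂volume.restrict (Set.Ioc 0 1),
        branchSum G d 1 (fun t => v (t : UnitAddCircle)) x = v (x : UnitAddCircle) := by
      have h1 := (UnitAddCircle.measurePreserving_mk 0).quasiMeasurePreserving.ae hv.fixed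
      rw [zero_add] at h1
      filter_upwards [h1] with x hx
      rw [← h.transfer_eq hFT (by omega)]
      exact hx
    have h0 := hG.integral_abs_sub_eq_zero hρ hC hv.integrable hv.integral_eq_one hae
    simp only [← hwρ'] at h0
    rw [← integral_circle_eq fun x => |v x - w x|,
      integral_eq_zero_iff_of_nonneg (f := fun x => |v x - w x|) (fun x => abs_nonneg _)
        (hv.integrable.sub hint).abs] at h0
    filter_upwards [h0] with x hx
    exact sub_eq_zero.1 (abs_eq_zero.1 hx)

/-! ### The resolvent on functions of mean zero -/

theorem eq_iterate_add_sum {G : ℝ → ℝ} {d : ℕ} {u v : ℝ → ℝ}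
    (huv : ∀ x, v x = u x - branchSum G d 1 u x) (n : ℕ) (x : ℝ) :
    u x = (branchSum G d 1)^[n] u x + ∑ k ∈ Finset.range n, (branchSum G d 1)^[k] v x := by
  induction n with
  | zero => simp
  | succ n ih =>
    rw [Finset.sum_range_succ, show v = fun t => u t - branchSum G d 1 u t from funext huv,
      iterate_branchSum_sub, ← Function.iterate_succ_apply]
    rw [show v = fun t => u t - branchSum G d 1 u t from funext huv] at ih
    linarith

/-- A bound for `u` in terms of `v = u - L u` which is small as soon as `v` is uniformly small and
has a bounded Lipschitz constant. It interpolates between the uniform bound of the iterates and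
their exponential decay on Lipschitz functions, and depends on the map only through `θ` and `D`. -/
theorem InverseLift.abs_le_of_sub_branchSum {G : ℝ → ℝ} {d : ℕ} {θ D : ℝ}
    (hG : InverseLift G d θ D) {u v : ℝ → ℝ} (hup : Function.Periodic u 1) (hu : ContDiff ℝ 1 u)
    (hu0 : ∫ x in (0 : ℝ)..1, u x = 0) (huv : ∀ x, v x = u x - branchSum G d 1 u x) {ν L : ℝ}
    (hL : 0 ≤ L) (hν : ∀ x, |v x| ≤ ν) (hv : ∀ x y, |v x - v y| ≤ L * |x - y|) (x : ℝ) :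
    |u x| ≤ Real.exp (coneWidth θ D) * √(ν * (ν + L / coneWidth θ D))
      / (1 - √(couplingRate θ D)) := by
  have ha := hG.coneWidth_pos
  have hq0 := hG.couplingRate_nonneg
  have hq := hG.couplingRate_lt_one
  have hE := Real.exp_pos (coneWidth θ D)
  set E := Real.exp (coneWidth θ D) with hEdef
  set q := couplingRate θ D
  have hν0 : 0 ≤ ν := (abs_nonneg _).trans (hν 0)
  have hsq1 : √q < 1 := by rw [Real.sqrt_lt' one_pos]; simpa using hq
  have hsq0 : 0 ≤ √q := Real.sqrt_nonneg q
  have hP := hG.continuous_branchSum hu.continuous 1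
  have hvc : Continuous v := by
    rw [show v = fun t => u t - branchSum G d 1 u t from funext huv]
    exact hu.continuous.sub hP
  have hvp : Function.Periodic v 1 := fun t => by
    simp only [huv, hup t, hG.periodic hup 1 t]
  have hui := hu.continuous.intervalIntegrable (μ := volume) 0 1
  have hv0 : ∫ x in (0 : ℝ)..1, v x = 0 := by
    simp only [huv]
    rw [intervalIntegral.integral_sub hui (hP.intervalIntegrable 0 1),
      hG.integral_branchSum hup hui, sub_self]
  set R := √(ν * (ν + L / coneWidth θ D)) with hR
  have hterm : ∀ k, |(branchSum G d 1)^[k] v x| ≤ E * R * √q ^ k := by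
    intro k
    have h1 := hG.abs_iterate_le_exp_mul hν k x
    have h2 := hG.abs_iterate_le hvp hvc hL hν hv hv0 k x
    refine abs_le_of_sq_le_sq ?_ (by positivity)
    rw [← sq_abs, mul_pow, mul_pow, ← pow_mul, mul_comm k 2, pow_mul, Real.sq_sqrt hq0, hR,
      Real.sq_sqrt (by positivity)]
    calc |(branchSum G d 1)^[k] v x| ^ 2
        = |(branchSum G d 1)^[k] v x| * |(branchSum G d 1)^[k] v x| := sq _
      _ ≤ (E * ν) * (E * (ν + L / coneWidth θ D) * q ^ k) :=
          mul_le_mul h1 h2 (abs_nonneg _) (by positivity)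
      _ = _ := by ring
  have hsum : ∀ n, |∑ k ∈ Finset.range n, (branchSum G d 1)^[k] v x| ≤ E * R / (1 - √q) := by
    intro n
    refine (Finset.abs_sum_le_sum_abs _ _).trans ((Finset.sum_le_sum fun k _ => hterm k).trans ?_)
    rw [← Finset.mul_sum, div_eq_mul_inv]
    refine mul_le_mul_of_nonneg_left ?_ (by positivity)
    rw [← tsum_geometric_of_lt_one hsq0 hsq1]
    exact (summable_geometric_of_lt_one hsq0 hsq1).sum_le_tsum _ fun k _ => by positivity
  obtain ⟨M, hM0, hM⟩ := exists_abs_le_of_periodic hup hu.continuous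
  obtain ⟨l, hl0, hl⟩ := exists_lipschitz_of_periodic hup hu
  have hall : ∀ n : ℕ, |u x| ≤ E * (M + l / coneWidth θ D) * q ^ n + E * R / (1 - √q) := fun n => by
    rw [eq_iterate_add_sum huv n x]
    exact (abs_add_le _ _).trans
      (add_le_add (hG.abs_iterate_le hup hu.continuous hl0.le hM hl hu0 n x) (hsum n))
  have hlim : Tendsto (fun n : ℕ => E * (M + l / coneWidth θ D) * q ^ n + E * R / (1 - √q)) atTop
      (𝓝 (E * (M + l / coneWidth θ D) * 0 + E * R / (1 - √q))) :=
    ((tendsto_pow_atTop_nhds_zero_of_lt_one hq0 hq).const_mul _).add_const _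
  simpa using ge_of_tendsto' hlim hall

/-! ### First order expansion of the transfer operator -/

/-- A first order Taylor estimate for a function with Lipschitz derivative. -/
theorem abs_taylor_le {h : ℝ → ℝ} (hh : Differentiable ℝ h) {A : ℝ}
    (hA : ∀ x y, |deriv h x - deriv h y| ≤ A * |x - y|) (x e : ℝ) :
    |h (x + e) - h x - deriv h x * e| ≤ A * e ^ 2 := by
  have hd : ∀ t, HasDerivAt (fun t => h (x + t) - deriv h x * t) (deriv h (x + t) - deriv h x) t :=
    fun t => by
      have h1 := (hh (x + t)).hasDerivAt.comp_const_add x t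
      simpa using h1.fun_sub ((hasDerivAt_id t).const_mul (deriv h x))
  have := Convex.norm_image_sub_le_of_norm_hasDerivWithin_le (s := Set.uIcc 0 e) (C := A * |e|)
    (fun t _ => (hd t).hasDerivWithinAt) (fun t ht => ?_) (convex_uIcc 0 e) Set.left_mem_uIcc
    Set.right_mem_uIcc
  · simp only [mul_zero, sub_zero, add_zero, Real.norm_eq_abs] at this
    rw [show h (x + e) - h x - deriv h x * e = h (x + e) - deriv h x * e - h x by ring]
    refine this.trans_eq ?_
    rw [mul_assoc, ← sq, sq_abs]
  · rw [Real.norm_eq_abs]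
    refine (hA _ _).trans ?_
    rw [add_sub_cancel_left]
    have hA0 : 0 ≤ A := by simpa using (abs_nonneg _).trans (hA 1 0)
    refine mul_le_mul_of_nonneg_left ?_ hA0
    have := Set.abs_sub_left_of_mem_uIcc ht
    simpa using this

theorem abs_inv_sub_inv_le {p q : ℝ} (hp : 1 ≤ p) (hq : 1 ≤ q) : |q⁻¹ - p⁻¹| ≤ |q - p| := by
  have h1 : (1 : ℝ) ≤ q * p := by nlinarith
  rw [inv_sub_inv (by positivity) (by positivity), abs_div, abs_sub_comm,
    abs_of_pos (by positivity : 0 < q * p)]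
  exact div_le_self (abs_nonneg _) h1

theorem abs_inv_le_one {p : ℝ} (hp : 1 ≤ p) : |p⁻¹| ≤ 1 := by
  rw [abs_of_nonneg (by positivity)]
  exact inv_le_one_of_one_le₀ hp

theorem abs_mul_le_mul {a b A B : ℝ} (ha : |a| ≤ A) (hb : |b| ≤ B) : |a * b| ≤ A * B := by
  rw [abs_mul]
  exact mul_le_mul ha hb (abs_nonneg _) ((abs_nonneg _).trans ha)

theorem abs_five_terms_le {a b c d e A B C D E : ℝ} (ha : |a| ≤ A) (hb : |b| ≤ B) (hc : |c| ≤ C)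
    (hd : |d| ≤ D) (he : |e| ≤ E) : |a - b - c - d - e| ≤ A + B + C + D + E :=
  (abs_sub _ _).trans (add_le_add ((abs_sub _ _).trans (add_le_add ((abs_sub _ _).trans
    (add_le_add ((abs_sub _ _).trans (add_le_add ha hb)) hc)) hd)) he)

/-- The difference of two transfer operators as a sum over the inverse branches of the perturbed
map. Every term is the value at `y = G (x + j)` of a function which involves only the lift `F`. -/
theorem LiftPair.branchSum_sub_branchSum {k d : ℕ} {F G : ℝ → ℝ} (h : LiftPair k d F G)
    (hk : k ≠ 0) (G₀ w : ℝ → ℝ) (x : ℝ) :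
    branchSum G d 1 w x - branchSum G₀ d 1 w x = ∑ j ∈ Finset.range d,
      (w (G (x + j)) * (deriv F (G (x + j)))⁻¹
        - w (G₀ (F (G (x + j)))) * deriv G₀ (F (G (x + j)))) := by
  simp only [branchSum, pow_one, ← Finset.sum_sub_distrib, h.deriv_inv hk, h.right_inv]

theorem LiftPair.contDiff_branch {m d : ℕ} {F₀ G₀ w : ℝ → ℝ} (h₀ : LiftPair (m + 1) d F₀ G₀)
    (hw : ContDiff ℝ m w) : ContDiff ℝ m fun z => w (G₀ z) * deriv G₀ z :=
  (hw.comp (h₀.contDiff_inv.of_le (by exact_mod_cast Nat.le_succ m))).mul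
    (contDiff_deriv_of_succ h₀.contDiff_inv)

theorem LiftPair.periodic_branch {k d : ℕ} {F₀ G₀ w : ℝ → ℝ} (h₀ : LiftPair k d F₀ G₀)
    (hw : Function.Periodic w 1) : Function.Periodic (fun z => w (G₀ z) * deriv G₀ z) d := by
  have h1 : ∀ z, G₀ (z + d) = G₀ z + 1 := fun z => by simpa using h₀.inv_add_int z 1
  have h2 : Function.Periodic (deriv G₀) d := fun z => by
    rw [← deriv_comp_add_const, show (fun z => G₀ (z + d)) = fun z => G₀ z + 1 from funext h1,
      deriv_add_const]
  intro z
  simp only [h1, hw (G₀ z), h2 z]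

/-- The difference of the transfer operators of two `C^2`-close maps has a small Lipschitz
constant on a fixed `C^2` function. -/
theorem LiftPair.exists_lipschitz_branchSum_sub {d : ℕ} {F₀ G₀ w : ℝ → ℝ}
    (h₀ : LiftPair 3 d F₀ G₀) (hw : ContDiff ℝ 2 w) (hwp : Function.Periodic w 1) :
    ∃ K, 0 < K ∧ ∀ (σ : ℝ) (F G : ℝ → ℝ), σ ≤ 1 → LiftPair 2 d F G → (∀ t, |F t - F₀ t| ≤ σ) →
      (∀ t, |deriv F t - deriv F₀ t| ≤ σ) → (∀ t, |deriv (deriv F) t - deriv (deriv F₀) t| ≤ σ) →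
      ∀ x y, |(branchSum G d 1 w x - branchSum G₀ d 1 w x)
        - (branchSum G d 1 w y - branchSum G₀ d 1 w y)| ≤ K * σ * |x - y| := by
  have hd0 : (d : ℝ) ≠ 0 := by exact_mod_cast (h₀.degree_pos).ne'
  have hdp : (0 : ℝ) < d := by exact_mod_cast h₀.degree_pos
  set h : ℝ → ℝ := fun z => w (G₀ z) * deriv G₀ z with hh
  have hhc : ContDiff ℝ 2 h := h₀.contDiff_branch (m := 2) hw
  have hhp : Function.Periodic h d := h₀.periodic_branch hwp
  have hh1 : ContDiff ℝ 1 (deriv h) := contDiff_deriv_of_succ (m := 1) hhc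
  have hF1 : ContDiff ℝ 2 (deriv F₀) := contDiff_deriv_of_succ (m := 2) h₀.contDiff
  have hF2 : ContDiff ℝ 1 (deriv (deriv F₀)) := contDiff_deriv_of_succ (m := 1) hF1
  have hwd : Differentiable ℝ w := hw.differentiable two_ne_zero
  have hhd : Differentiable ℝ h := hhc.differentiable two_ne_zero
  obtain ⟨A1, _, hA1⟩ := exists_abs_le_of_periodic hwp hw.continuous
  obtain ⟨A2, _, hA2⟩ := exists_abs_le_of_periodic (CircleResponse.periodic_deriv hwp)
    (hw.continuous_deriv one_le_two)
  obtain ⟨A3, _, hA3⟩ := exists_abs_le_of_periodic h₀.periodic_deriv hF1.continuous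
  obtain ⟨A4, _, hA4⟩ := exists_abs_le_of_periodic (CircleResponse.periodic_deriv h₀.periodic_deriv)
    hF2.continuous
  obtain ⟨A5, _, hA5⟩ := exists_abs_le_of_periodic_ne_zero (CircleResponse.periodic_deriv hhp) hd0
    hh1.continuous
  obtain ⟨A6, _, hA6⟩ := exists_lipschitz_of_periodic_ne_zero (CircleResponse.periodic_deriv hhp)
    hd0 hh1
  set A := A1 + A2 + A3 + A4 + A5 + A6 with hA
  have hA0 : 0 < A := by positivity
  refine ⟨d * (4 * A + 3 * A ^ 2), by positivity, fun σ F G hσ h' hF hF' hF'' x y => ?_⟩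
  have hσ0 : 0 ≤ σ := (abs_nonneg _).trans (hF 0)
  have hFd := h'.differentiable two_ne_zero
  have hFd1 : ContDiff ℝ 1 (deriv F) := contDiff_deriv_of_succ (m := 1) h'.contDiff
  set Δ : ℝ → ℝ := fun y => w y * (deriv F y)⁻¹ - h (F y) with hΔ
  have hder : ∀ y, HasDerivAt Δ (deriv w y * (deriv F y)⁻¹
      + w y * (-deriv (deriv F) y / deriv F y ^ 2) - deriv h (F y) * deriv F y) y := fun y =>
    ((hwd y).hasDerivAt.mul (((hFd1.differentiable one_ne_zero) y).hasDerivAt.fun_inv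
      (by linarith [h'.one_lt y]))).fun_sub ((hhd (F y)).hasDerivAt.comp y (hFd y).hasDerivAt)
  -- the same identity for the unperturbed map, for which the function above vanishes
  have hzero : ∀ y, deriv w y * (deriv F₀ y)⁻¹
      + w y * (-deriv (deriv F₀) y / deriv F₀ y ^ 2) - deriv h (F₀ y) * deriv F₀ y = 0 := by
    intro y
    have h1 := ((hwd y).hasDerivAt.mul (((hF1.differentiable two_ne_zero) y).hasDerivAt.fun_inv
      (by linarith [h₀.one_lt y]))).fun_sub
      ((hhd (F₀ y)).hasDerivAt.comp y (h₀.differentiable (by norm_num) y).hasDerivAt)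
    have h2 : (fun y => (w * fun y => (deriv F₀ y)⁻¹) y - (h ∘ F₀) y) = fun _ => 0 := by
      ext y
      simp only [hh, Function.comp, Pi.mul_apply, h₀.left_inv, h₀.deriv_inv_apply (by norm_num),
        sub_self]
    rw [h2] at h1
    exact h1.unique (hasDerivAt_const y 0)
  have hbound : ∀ y, |deriv Δ y| ≤ (4 * A + 3 * A ^ 2) * σ := by
    intro y
    rw [(hder y).deriv]
    have hp := (h₀.one_lt y).le
    have hq := (h'.one_lt y).le
    have e1 := hF' y
    have e2 := hF'' y
    have b1 : |w y| ≤ A := (hA1 y).trans (by linarith)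
    have b2 : |deriv w y| ≤ A := (hA2 y).trans (by linarith)
    have b3 : |deriv F₀ y| ≤ A := (hA3 y).trans (by linarith)
    have b4 : |deriv (deriv F₀) y| ≤ A := (hA4 y).trans (by linarith)
    have b5 : |deriv h (F₀ y)| ≤ A := (hA5 _).trans (by linarith)
    have b6 : |deriv h (F y) - deriv h (F₀ y)| ≤ A * σ :=
      (hA6 _ _).trans (mul_le_mul (by linarith) (hF y) (abs_nonneg _) hA0.le)
    have hz := hzero y
    generalize deriv F y = q at *
    generalize deriv F₀ y = p at *
    generalize deriv (deriv F) y = q2 at *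
    generalize deriv (deriv F₀) y = p2 at *
    have bq : |q| ≤ A + 1 := by
      have := abs_add_le (q - p) p
      rw [sub_add_cancel] at this
      linarith
    have c1 : |q⁻¹ - p⁻¹| ≤ σ := (abs_inv_sub_inv_le hp hq).trans e1
    have c2 : |q⁻¹ ^ 2 - p⁻¹ ^ 2| ≤ 2 * σ := by
      rw [sq_sub_sq]
      exact abs_mul_le_mul ((abs_add_le _ _).trans
        (by linarith [abs_inv_le_one hp, abs_inv_le_one hq])) c1
    have c3 : |q⁻¹ ^ 2| ≤ 1 := by
      rw [abs_pow]; exact pow_le_one₀ (abs_nonneg _) (abs_inv_le_one hq)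
    have t1 := abs_mul_le_mul b2 c1
    have t2 := abs_mul_le_mul (abs_mul_le_mul b1 e2) c3
    have t3 := abs_mul_le_mul (abs_mul_le_mul b1 b4) c2
    have t4 := abs_mul_le_mul b6 bq
    have t5 := abs_mul_le_mul b5 e1
    have e : deriv w y * q⁻¹ + w y * (-q2 / q ^ 2) - deriv h (F y) * q
        = deriv w y * (q⁻¹ - p⁻¹) - w y * (q2 - p2) * q⁻¹ ^ 2 - w y * p2 * (q⁻¹ ^ 2 - p⁻¹ ^ 2)
          - (deriv h (F y) - deriv h (F₀ y)) * q - deriv h (F₀ y) * (q - p) := by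
      rw [div_eq_mul_inv, ← inv_pow] at hz ⊢
      linear_combination hz
    rw [e]
    exact (abs_five_terms_le t1 t2 t3 t4 t5).trans_eq (by ring)
  have hΔl := abs_sub_le_of_abs_deriv_le (fun y => (hder y).differentiableAt) hbound
  have hG1 : ∀ x, |deriv G x| ≤ 1 := fun x => by
    rw [h'.deriv_inv two_ne_zero]
    exact abs_inv_le_one (h'.one_lt _).le
  rw [h'.branchSum_sub_branchSum two_ne_zero, h'.branchSum_sub_branchSum two_ne_zero,
    ← Finset.sum_sub_distrib]
  have hK0 : 0 ≤ (4 * A + 3 * A ^ 2) * σ := by positivity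
  calc _ ≤ ∑ j ∈ Finset.range d, |Δ (G (x + j)) - Δ (G (y + j))| := Finset.abs_sum_le_sum_abs _ _
    _ ≤ ∑ j ∈ Finset.range d, (4 * A + 3 * A ^ 2) * σ * |x - y| := by
      refine Finset.sum_le_sum fun j _ => (hΔl _ _).trans (mul_le_mul_of_nonneg_left ?_ hK0)
      have := abs_sub_le_of_abs_deriv_le (h'.differentiable_inv two_ne_zero) hG1 (x + j) (y + j)
      rwa [one_mul, add_sub_add_right_eq_sub] at this
    _ = _ := by rw [Finset.sum_const, Finset.card_range, nsmul_eq_mul]; ring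

/-- The first order expansion of the transfer operator on a fixed `C^2` function `w`: for
`F = F₀ + δ ε + r` the derivative at `δ = 0` is `-(L₀ (ε w))'`. -/
theorem LiftPair.exists_branchSum_first_order {d : ℕ} {F₀ G₀ w ε : ℝ → ℝ}
    (h₀ : LiftPair 3 d F₀ G₀) (hw : ContDiff ℝ 2 w) (hwp : Function.Periodic w 1)
    (hε : ContDiff ℝ 2 ε) (hεp : Function.Periodic ε 1) :
    ∃ K, 0 < K ∧ ∀ (δ s : ℝ) (F G r : ℝ → ℝ), |δ| ≤ 1 → s ≤ 1 → LiftPair 2 d F G →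
      (∀ t, F t = F₀ t + (δ * ε t + r t)) → Differentiable ℝ r → (∀ t, |r t| ≤ s * |δ|) →
      (∀ t, |deriv r t| ≤ s * |δ|) →
      ∀ x, |(branchSum G d 1 w x - branchSum G₀ d 1 w x)
        + δ * deriv (branchSum G₀ d 1 fun t => w t * ε t) x| ≤ K * |δ| * (s + |δ|) := by
  have hd0 : (d : ℝ) ≠ 0 := by exact_mod_cast (h₀.degree_pos).ne'
  have hdp : (0 : ℝ) < d := by exact_mod_cast h₀.degree_pos
  set h : ℝ → ℝ := fun z => w (G₀ z) * deriv G₀ z with hh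
  have hhc : ContDiff ℝ 2 h := h₀.contDiff_branch (m := 2) hw
  have hhp : Function.Periodic h d := h₀.periodic_branch hwp
  have hh1 : ContDiff ℝ 1 (deriv h) := contDiff_deriv_of_succ (m := 1) hhc
  set g : ℝ → ℝ := fun z => w (G₀ z) * ε (G₀ z) * deriv G₀ z with hg
  have hgc : ContDiff ℝ 2 g := h₀.contDiff_branch (m := 2) (hw.mul hε)
  have hgp : Function.Periodic g d := h₀.periodic_branch (w := fun t => w t * ε t)
    fun t => by simp only [hwp t, hεp t]
  have hg1 : ContDiff ℝ 1 (deriv g) := contDiff_deriv_of_succ (m := 1) hgc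
  have hhd : Differentiable ℝ h := hhc.differentiable two_ne_zero
  have hgd : Differentiable ℝ g := hgc.differentiable two_ne_zero
  have hεd : Differentiable ℝ ε := hε.differentiable two_ne_zero
  have hsum : ∀ x, deriv (branchSum G₀ d 1 fun t => w t * ε t) x
      = ∑ j ∈ Finset.range d, deriv g (x + j) := by
    intro x
    have h1 : HasDerivAt (fun x => ∑ j ∈ Finset.range d, g (x + j))
        (∑ j ∈ Finset.range d, deriv g (x + j)) x :=
      HasDerivAt.fun_sum fun j _ => (hgd (x + j)).hasDerivAt.comp_add_const x (j : ℝ)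
    rw [← h1.deriv]
    congr 1
    ext x
    simp [branchSum, hg]
  -- the derivative of `g` along the unperturbed map
  have hgF : ∀ y, deriv g (F₀ y)
      = deriv h (F₀ y) * ε y + w y * deriv ε y * (deriv F₀ y)⁻¹ ^ 2 := by
    intro y
    have h1 : HasDerivAt g _ (F₀ y) := (hhd (F₀ y)).hasDerivAt.fun_mul
      ((hεd (G₀ (F₀ y))).hasDerivAt.comp (F₀ y)
        (h₀.differentiable_inv (by norm_num) (F₀ y)).hasDerivAt) |>.congr_of_eventuallyEq
        (Eventually.of_forall fun z => by simp only [hg, hh, Function.comp]; ring)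
    rw [h1.deriv]
    simp only [hh, Function.comp, h₀.left_inv, h₀.deriv_inv_apply (by norm_num : (3 : ℕ) ≠ 0)]
    ring
  have hhF : ∀ y, h (F₀ y) = w y * (deriv F₀ y)⁻¹ := fun y => by
    simp only [hh, h₀.left_inv, h₀.deriv_inv_apply (by norm_num : (3 : ℕ) ≠ 0)]
  obtain ⟨A1, _, hA1⟩ := exists_abs_le_of_periodic hwp hw.continuous
  obtain ⟨A2, _, hA2⟩ := exists_abs_le_of_periodic hεp hε.continuous
  obtain ⟨A3, _, hA3⟩ := exists_abs_le_of_periodic (CircleResponse.periodic_deriv hεp)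
    (hε.continuous_deriv one_le_two)
  obtain ⟨A4, _, hA4⟩ := exists_abs_le_of_periodic_ne_zero (CircleResponse.periodic_deriv hhp) hd0
    hh1.continuous
  obtain ⟨A5, _, hA5⟩ := exists_lipschitz_of_periodic_ne_zero (CircleResponse.periodic_deriv hhp)
    hd0 hh1
  obtain ⟨A6, _, hA6⟩ := exists_lipschitz_of_periodic_ne_zero (CircleResponse.periodic_deriv hgp)
    hd0 hg1
  set A := A1 + A2 + A3 + A4 + A5 + A6 with hA
  have hA0 : 0 < A := by positivity
  set B := 2 * A + (2 * A * (A + 1) ^ 2 + A * (A + 1)) with hB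
  refine ⟨d * B, by positivity, fun δ s F G r hδ hs h' hF hr hr0 hr1 x => ?_⟩
  have hder : ∀ y, deriv F y = deriv F₀ y + (δ * deriv ε y + deriv r y) := fun y => by
    have h1 := ((h₀.differentiable (by norm_num) y).hasDerivAt).fun_add
      (((hεd y).hasDerivAt.const_mul δ).fun_add (hr y).hasDerivAt)
    rw [show F = fun t => F₀ t + (δ * ε t + r t) from funext hF]
    exact h1.deriv
  have key : ∀ y, |w y * (deriv F y)⁻¹ - h (F y) + δ * deriv g (F y)| ≤ B * (|δ| * (s + |δ|)) := by
    intro y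
    have hp := (h₀.one_lt y).le
    have hq := (h'.one_lt y).le
    have b1 : |w y| ≤ A := (hA1 y).trans (by linarith)
    have b2 : |ε y| ≤ A := (hA2 y).trans (by linarith)
    have b3 : |deriv ε y| ≤ A := (hA3 y).trans (by linarith)
    have b4 : |deriv h (F₀ y)| ≤ A := (hA4 _).trans (by linarith)
    have hδ0 := abs_nonneg δ
    have he : ∀ a b : ℝ, |a| ≤ A → |b| ≤ s * |δ| → |δ * a + b| ≤ (A + 1) * |δ| := by
      intro a b ha hb
      have h1 := abs_mul_le_mul (le_refl |δ|) ha
      have h2 := mul_le_mul_of_nonneg_right hs hδ0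
      exact (abs_add_le _ _).trans (by linarith)
    have e0 := he _ _ b2 (hr0 y)
    have e1 := he _ _ b3 (hr1 y)
    have hq' := hder y
    have hFy := hF y
    have tay := abs_taylor_le hhd hA5 (F₀ y) (δ * ε y + r y)
    have hgl := hA6 (F y) (F₀ y)
    rw [← hFy, hhF] at tay
    rw [hFy, add_sub_cancel_left, ← hFy, hgF] at hgl
    have sq_le : ∀ e : ℝ, |e| ≤ (A + 1) * |δ| → e ^ 2 ≤ (A + 1) ^ 2 * |δ| ^ 2 := by
      intro e he
      rw [← sq_abs e, ← mul_pow]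
      exact pow_le_pow_left₀ (abs_nonneg _) he 2
    have s0 := sq_le _ e0
    have s1 := sq_le _ e1
    have hpp := abs_inv_le_one hp
    have hqq := abs_inv_le_one hq
    -- the second order Taylor remainder of the inverse
    have hinv : (deriv F y)⁻¹ = (deriv F₀ y)⁻¹
        - (δ * deriv ε y + deriv r y) * (deriv F₀ y)⁻¹ ^ 2
        + (δ * deriv ε y + deriv r y) ^ 2 * ((deriv F₀ y)⁻¹ ^ 2 * (deriv F y)⁻¹) := by
      have h1 : deriv F₀ y ≠ 0 := by positivity
      have h2 : deriv F y ≠ 0 := by positivity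
      rw [show δ * deriv ε y + deriv r y = deriv F y - deriv F₀ y by rw [hq']; ring]
      field_simp
      ring
    have hp2 : |(deriv F₀ y)⁻¹ ^ 2| ≤ 1 := by
      rw [abs_pow]; exact pow_le_one₀ (abs_nonneg _) hpp
    have t1 : |w y * deriv r y * (deriv F₀ y)⁻¹ ^ 2| ≤ A * (s * |δ|) * 1 :=
      abs_mul_le_mul (abs_mul_le_mul b1 (hr1 y)) hp2
    have t2 : |w y * (δ * deriv ε y + deriv r y) ^ 2 * ((deriv F₀ y)⁻¹ ^ 2 * (deriv F y)⁻¹)|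
        ≤ A * ((A + 1) ^ 2 * |δ| ^ 2) * (1 * 1) :=
      abs_mul_le_mul (abs_mul_le_mul b1 (by rw [abs_of_nonneg (sq_nonneg _)]; exact s1))
        (abs_mul_le_mul hp2 hqq)
    have t3 : |deriv h (F₀ y) * r y| ≤ A * (s * |δ|) := abs_mul_le_mul b4 (hr0 y)
    have t4 := tay.trans (mul_le_mul (by linarith : A5 ≤ A) s0 (sq_nonneg _) hA0.le)
    have t5 := abs_mul_le_mul (le_refl |δ|)
      (hgl.trans (mul_le_mul (by linarith : A6 ≤ A) e0 (abs_nonneg _) hA0.le))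
    have e : w y * (deriv F y)⁻¹ - h (F y) + δ * deriv g (F y)
        = δ * (deriv g (F y)
            - (deriv h (F₀ y) * ε y + w y * deriv ε y * (deriv F₀ y)⁻¹ ^ 2))
          - w y * deriv r y * (deriv F₀ y)⁻¹ ^ 2 - deriv h (F₀ y) * r y
          - (h (F y) - w y * (deriv F₀ y)⁻¹ - deriv h (F₀ y) * (δ * ε y + r y))
          - -(w y * (δ * deriv ε y + deriv r y) ^ 2
            * ((deriv F₀ y)⁻¹ ^ 2 * (deriv F y)⁻¹)) := by
      linear_combination w y * hinv
    rw [e]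
    rw [← abs_neg] at t2
    refine (abs_five_terms_le t5 t1 t3 t4 t2).trans ?_
    have hs0 : 0 ≤ s * |δ| := (abs_nonneg _).trans (hr0 y)
    have hpos : 0 ≤ (2 * A * (A + 1) ^ 2 + A * (A + 1)) * (s * |δ|) := by positivity
    have hpos' : 0 ≤ 2 * A * |δ| ^ 2 := by positivity
    rw [hB]
    linarith
  rw [h'.branchSum_sub_branchSum two_ne_zero, hsum, Finset.mul_sum, ← Finset.sum_add_distrib]
  calc _ ≤ ∑ j ∈ Finset.range d, |w (G (x + j)) * (deriv F (G (x + j)))⁻¹ - h (F (G (x + j)))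
          + δ * deriv g (F (G (x + j)))| := by
        simp only [h'.right_inv]
        exact Finset.abs_sum_le_sum_abs _ _
    _ ≤ ∑ j ∈ Finset.range d, B * (|δ| * (s + |δ|)) := Finset.sum_le_sum fun j _ => key _
    _ = _ := by rw [Finset.sum_const, Finset.card_range, nsmul_eq_mul]; ring

/-! ### Linear response -/

/-- The perturbation that realises `ρ₁`: with `Q' = ρ₁ - L₀ ρ₁` the choice
`ε = -(Q / ρ₀) ∘ F₀` gives `L₀ (ε ρ₀) = -Q`, because `L₀ ((g ∘ F₀) ρ₀) = g L₀ ρ₀ = g ρ₀`. -/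
theorem LiftPair.exists_perturbation {d : ℕ} {F₀ G₀ ρ₀ ρ₁ : ℝ → ℝ} {θ D : ℝ}
    (h₀ : LiftPair 5 d F₀ G₀) (hG₀ : InverseLift G₀ d θ D) (hρ₀ : ContDiff ℝ 4 ρ₀)
    (hρ₀p : Function.Periodic ρ₀ 1) (hpos : ∀ x, 0 < ρ₀ x)
    (hfix : ∀ x, branchSum G₀ d 1 ρ₀ x = ρ₀ x) (hρ₁ : ContDiff ℝ 3 ρ₁)
    (hρ₁p : Function.Periodic ρ₁ 1) :
    ∃ ε : ℝ → ℝ, ContDiff ℝ 4 ε ∧ Function.Periodic ε 1 ∧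
      ∀ x, deriv (branchSum G₀ d 1 fun t => ρ₀ t * ε t) x = -(ρ₁ x - branchSum G₀ d 1 ρ₁ x) := by
  have hPc : ContDiff ℝ 3 (branchSum G₀ d 1 ρ₁) :=
    contDiff_branchSum (m := 3) (h₀.of_le (by norm_num : 4 ≤ 5)).contDiff_inv hρ₁
  have hNc : ContDiff ℝ 3 fun x => ρ₁ x - branchSum G₀ d 1 ρ₁ x := hρ₁.sub hPc
  have hNp : Function.Periodic (fun x => ρ₁ x - branchSum G₀ d 1 ρ₁ x) 1 := fun x => by
    simp only [hρ₁p x, hG₀.periodic hρ₁p 1 x]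
  have hρ₁i := hρ₁.continuous.intervalIntegrable (μ := volume) 0 1
  have hN0 : ∫ x in (0 : ℝ)..1, (ρ₁ x - branchSum G₀ d 1 ρ₁ x) = 0 := by
    rw [intervalIntegral.integral_sub hρ₁i (hPc.continuous.intervalIntegrable 0 1),
      hG₀.integral_branchSum hρ₁p hρ₁i, sub_self]
  set N : ℝ → ℝ := fun x => ρ₁ x - branchSum G₀ d 1 ρ₁ x with hN
  set Q : ℝ → ℝ := fun x => ∫ t in (0 : ℝ)..x, N t with hQ
  have hQd : ∀ x, HasDerivAt Q (N x) x := fun x =>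
    (hNc.continuous.integral_hasStrictDerivAt 0 x).hasDerivAt
  have hQc : ContDiff ℝ 4 Q := contDiff_succ_of_deriv (m := 3) (fun x => (hQd x).differentiableAt)
    (by rw [show deriv Q = N from funext fun x => (hQd x).deriv]; exact hNc)
  have hQp : Function.Periodic Q 1 := fun x => by
    simp only [hQ]
    rw [← intervalIntegral.integral_add_adjacent_intervals (hNc.continuous.intervalIntegrable 0 x)
      (hNc.continuous.intervalIntegrable x (x + 1)), hNp.intervalIntegral_add_eq x 0, zero_add,
      hN0, add_zero]
  have hgp : Function.Periodic (fun x => Q x / ρ₀ x) 1 := fun x => by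
    simp only [hQp x, hρ₀p x]
  have hgc : ContDiff ℝ 4 fun x => Q x / ρ₀ x := hQc.div hρ₀ fun x => (hpos x).ne'
  have hgn : ∀ (x : ℝ) (n : ℕ), Q (x + n) / ρ₀ (x + n) = Q x / ρ₀ x := fun x n => by
    simpa using hgp.nat_mul n x
  refine ⟨fun t => -(Q (F₀ t) / ρ₀ (F₀ t)), ?_, fun t => ?_, fun x => ?_⟩
  · exact (hgc.comp (h₀.of_le (by norm_num : 4 ≤ 5)).contDiff).neg
  · simp only [h₀.add_one, hgn]
  · have h1 : (branchSum G₀ d 1 fun t => ρ₀ t * -(Q (F₀ t) / ρ₀ (F₀ t))) = fun x => -Q x := by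
      ext x
      have h2 : (branchSum G₀ d 1 fun t => ρ₀ t * -(Q (F₀ t) / ρ₀ (F₀ t))) x
          = -(Q x / ρ₀ x) * branchSum G₀ d 1 ρ₀ x := by
        simp only [branchSum, h₀.right_inv, hgn, Finset.mul_sum]
        exact Finset.sum_congr rfl fun j _ => by ring
      rw [h2, hfix]
      field_simp [(hpos x).ne']
    rw [h1]
    exact (hQd x).fun_neg.deriv

/-- Linear response in the uniform norm: for all maps `F₀ + δ ε + r` with `r` of size `s |δ|` in
`C^2`, the difference quotient of the densities is close to `ρ₁` once `δ` and `s` are small. -/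
theorem LiftPair.exists_response_bound {d : ℕ} {F₀ G₀ ρ₀ ρ₁ ε : ℝ → ℝ}
    (h₀ : LiftPair 3 d F₀ G₀) (hρ₀ : ContDiff ℝ 2 ρ₀) (hρ₀p : Function.Periodic ρ₀ 1)
    (hρ₀m : ∫ x in (0 : ℝ)..1, ρ₀ x = 1) (hfix : ∀ x, branchSum G₀ d 1 ρ₀ x = ρ₀ x)
    (hρ₁ : ContDiff ℝ 2 ρ₁) (hρ₁p : Function.Periodic ρ₁ 1)
    (hρ₁m : ∫ x in (0 : ℝ)..1, ρ₁ x = 0) (hε : ContDiff ℝ 2 ε) (hεp : Function.Periodic ε 1)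
    (heq : ∀ x, deriv (branchSum G₀ d 1 fun t => ρ₀ t * ε t) x = -(ρ₁ x - branchSum G₀ d 1 ρ₁ x))
    {e : ℝ} (he : 0 < e) :
    ∃ κ, 0 < κ ∧ ∀ (δ s : ℝ) (F G r ρ : ℝ → ℝ), δ ≠ 0 → |δ| < κ → s < κ → LiftPair 2 d F G →
      (∀ t, F t = F₀ t + (δ * ε t + r t)) → ContDiff ℝ 2 r → (∀ t, |r t| ≤ s * |δ|) →
      (∀ t, |deriv r t| ≤ s * |δ|) → (∀ t, |deriv (deriv r) t| ≤ s * |δ|) →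
      ContDiff ℝ 1 ρ → Function.Periodic ρ 1 → ∫ x in (0 : ℝ)..1, ρ x = 1 →
      (∀ x, branchSum G d 1 ρ x = ρ x) → ∀ x, |(ρ x - ρ₀ x) / δ - ρ₁ x| ≤ e := by
  obtain ⟨l₀, D₀, hl₀, hFl₀, hD₀, hFD₀⟩ := h₀.exists_deriv_bounds (by norm_num)
  have hG₀ := h₀.inverseLift (by norm_num) hl₀ hFl₀ hD₀ hFD₀
  have hε1 : ContDiff ℝ 1 (deriv ε) := contDiff_deriv_of_succ (m := 1) hε
  obtain ⟨A1, _, hA1⟩ := exists_abs_le_of_periodic hεp hε.continuous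
  obtain ⟨A2, _, hA2⟩ := exists_abs_le_of_periodic (CircleResponse.periodic_deriv hεp)
    hε1.continuous
  obtain ⟨A3, _, hA3⟩ := exists_abs_le_of_periodic
    (CircleResponse.periodic_deriv (CircleResponse.periodic_deriv hεp))
    (hε1.continuous_deriv le_rfl)
  set A := A1 + A2 + A3 with hA
  have hA0 : 0 < A := by positivity
  obtain ⟨K1, hK1, hlip0⟩ := h₀.exists_lipschitz_branchSum_sub hρ₀ hρ₀p
  obtain ⟨K2, hK2, hlip1⟩ := h₀.exists_lipschitz_branchSum_sub hρ₁ hρ₁p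
  obtain ⟨K3, hK3, hfo0⟩ := h₀.exists_branchSum_first_order hρ₀ hρ₀p hε hεp
  obtain ⟨K4, hK4, hfo1⟩ := h₀.exists_branchSum_first_order hρ₁ hρ₁p hε hεp
  have hPc : ∀ {w : ℝ → ℝ}, ContDiff ℝ 2 w → ContDiff ℝ 2 (branchSum G₀ d 1 w) := fun hw =>
    contDiff_branchSum (m := 2) h₀.contDiff_inv hw
  obtain ⟨B, hB, hM1⟩ := exists_abs_le_of_periodic
    (CircleResponse.periodic_deriv (hG₀.periodic (w := fun t => ρ₁ t * ε t)
      (fun t => by simp only [hρ₁p t, hεp t]) 1))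
    ((hPc (hρ₁.mul hε)).continuous_deriv one_le_two)
  obtain ⟨L1, hL1, hlipN⟩ := exists_lipschitz_of_periodic
    (f := fun x => ρ₁ x - branchSum G₀ d 1 ρ₁ x)
    (fun x => by simp only [hρ₁p x, hG₀.periodic hρ₁p 1 x])
    ((hρ₁.sub (hPc hρ₁)).of_le one_le_two)
  -- the constants of all maps close to `F₀`
  set θ := ((1 + l₀) / 2)⁻¹ with hθ
  set D := D₀ + 1 with hD
  set L := K1 * (A + 1) + L1 + K2 with hL
  obtain ⟨ν, hν0, hν⟩ : ∃ ν, 0 < ν ∧ Real.exp (coneWidth θ D) * √(ν * (ν + L / coneWidth θ D))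
      / (1 - √(couplingRate θ D)) < e := by
    have hc : Continuous fun ν => Real.exp (coneWidth θ D) * √(ν * (ν + L / coneWidth θ D))
        / (1 - √(couplingRate θ D)) := by fun_prop
    have ht := hc.tendsto 0
    simp only [zero_mul, Real.sqrt_zero, mul_zero, zero_div] at ht
    have hev : ∀ᶠ ν in 𝓝[>] (0 : ℝ), Real.exp (coneWidth θ D) * √(ν * (ν + L / coneWidth θ D))
        / (1 - √(couplingRate θ D)) < e := (ht.eventually_lt_const he).filter_mono nhdsWithin_le_nhds
    obtain ⟨ν, h1, h2⟩ := (hev.and self_mem_nhdsWithin).exists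
    exact ⟨ν, h2, h1⟩
  set κ := min (min 1 (1 / (A + 1))) (min ((l₀ - 1) / (2 * (A + 1))) (ν / (2 * K3 + B + 2 * K4)))
    with hκ
  have hκ0 : 0 < κ := by
    have : 0 < l₀ - 1 := by linarith
    rw [hκ]; positivity
  refine ⟨κ, hκ0, fun δ s F G r ρ hδ0 hδ hs h hF hr hr0 hr1 hr2 hρ hρp hρm hρfix x => ?_⟩
  have hδa : 0 < |δ| := abs_pos.2 hδ0
  have hs0 : 0 ≤ s := nonneg_of_mul_nonneg_left ((abs_nonneg _).trans (hr0 0)) hδa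
  have hκ1 : κ ≤ 1 := (min_le_left _ _).trans (min_le_left _ _)
  have hκ2 : κ * (A + 1) ≤ 1 := by
    have : κ ≤ 1 / (A + 1) := (min_le_left _ _).trans (min_le_right _ _)
    rwa [le_div_iff₀ (by positivity)] at this
  have hκ3 : κ * (2 * (A + 1)) ≤ l₀ - 1 := by
    have : κ ≤ (l₀ - 1) / (2 * (A + 1)) := (min_le_right _ _).trans (min_le_left _ _)
    rwa [le_div_iff₀ (by positivity)] at this
  have hκ4 : κ * (2 * K3 + B + 2 * K4) ≤ ν := by
    have : κ ≤ ν / (2 * K3 + B + 2 * K4) := (min_le_right _ _).trans (min_le_right _ _)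
    rwa [le_div_iff₀ (by positivity)] at this
  have hsum : ∀ a b : ℝ, |a| ≤ A → |b| ≤ s * |δ| → |δ * a + b| ≤ (A + 1) * |δ| := by
    intro a b ha hb
    have h1 := abs_mul_le_mul (le_refl |δ|) ha
    have h2 := mul_le_mul_of_nonneg_right (hs.le.trans hκ1) hδa.le
    exact (abs_add_le _ _).trans (by linarith)
  have hσκ : (A + 1) * |δ| ≤ κ * (A + 1) := by nlinarith
  have hrd : Differentiable ℝ r := hr.differentiable two_ne_zero
  have hr1d : Differentiable ℝ (deriv r) :=
    (contDiff_deriv_of_succ (m := 1) hr).differentiable one_ne_zero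
  have hεd : Differentiable ℝ ε := hε.differentiable two_ne_zero
  have hε1d : Differentiable ℝ (deriv ε) := hε1.differentiable one_ne_zero
  have hF₀d : Differentiable ℝ F₀ := h₀.differentiable (by norm_num)
  have hF₀1d : Differentiable ℝ (deriv F₀) :=
    (contDiff_deriv_of_succ (m := 2) h₀.contDiff).differentiable two_ne_zero
  have hF' : deriv F = fun y => deriv F₀ y + (δ * deriv ε y + deriv r y) := by
    ext y
    rw [show F = fun t => F₀ t + (δ * ε t + r t) from funext hF]
    exact ((hF₀d y).hasDerivAt.fun_add
      (((hεd y).hasDerivAt.const_mul δ).fun_add (hrd y).hasDerivAt)).deriv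
  have hF'' : ∀ y, deriv (deriv F) y
      = deriv (deriv F₀) y + (δ * deriv (deriv ε) y + deriv (deriv r) y) := fun y => by
    rw [hF']
    exact ((hF₀1d y).hasDerivAt.fun_add
      (((hε1d y).hasDerivAt.const_mul δ).fun_add (hr1d y).hasDerivAt)).deriv
  have c0 : ∀ t, |F t - F₀ t| ≤ (A + 1) * |δ| := fun t => by
    rw [hF, add_sub_cancel_left]
    exact hsum _ _ ((hA1 t).trans (by linarith)) (hr0 t)
  have c1 : ∀ t, |deriv F t - deriv F₀ t| ≤ (A + 1) * |δ| := fun t => by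
    rw [hF', add_sub_cancel_left]
    exact hsum _ _ ((hA2 t).trans (by linarith)) (hr1 t)
  have c2 : ∀ t, |deriv (deriv F) t - deriv (deriv F₀) t| ≤ (A + 1) * |δ| := fun t => by
    rw [hF'', add_sub_cancel_left]
    exact hsum _ _ ((hA3 t).trans (by linarith)) (hr2 t)
  have hG : InverseLift G d θ D := by
    refine h.inverseLift le_rfl (by linarith) (fun t => ?_) (by linarith) fun t => ?_
    · have h1 := (abs_le.1 (c1 t)).1
      have h2 := hFl₀ t
      linarith
    · have h1 := abs_le.1 (c2 t)
      have h2 := abs_le.1 (hFD₀ t)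
      rw [abs_le]
      constructor <;> linarith
  set S0 : ℝ → ℝ := fun x => branchSum G d 1 ρ₀ x - branchSum G₀ d 1 ρ₀ x with hS0
  set S1 : ℝ → ℝ := fun x => branchSum G d 1 ρ₁ x - branchSum G₀ d 1 ρ₁ x with hS1
  set N : ℝ → ℝ := fun x => ρ₁ x - branchSum G₀ d 1 ρ₁ x with hN
  have hδ1 : |δ| ≤ 1 := hδ.le.trans hκ1
  have hs1 : s ≤ 1 := hs.le.trans hκ1
  have hρi := hρ.continuous.intervalIntegrable (μ := volume) 0 1
  have hρ₀i := hρ₀.continuous.intervalIntegrable (μ := volume) 0 1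
  have hρ₁i := hρ₁.continuous.intervalIntegrable (μ := volume) 0 1
  refine (hG.abs_le_of_sub_branchSum (u := fun x => (ρ x - ρ₀ x) / δ - ρ₁ x)
    (v := fun x => S0 x / δ - N x + S1 x) (ν := ν) (L := L) (fun x => ?_) ?_ ?_ (fun x => ?_)
    (by positivity) (fun x => ?_) (fun x y => ?_) x).trans hν.le
  · simp only [hρp x, hρ₀p x, hρ₁p x]
  · exact ((hρ.sub (hρ₀.of_le one_le_two)).div_const δ).sub (hρ₁.of_le one_le_two)
  · rw [intervalIntegral.integral_sub ((hρi.sub hρ₀i).div_const δ) hρ₁i,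
      intervalIntegral.integral_div, intervalIntegral.integral_sub hρi hρ₀i, hρm, hρ₀m, hρ₁m]
    simp
  · have h1 : branchSum G d 1 (fun x => (ρ x - ρ₀ x) / δ - ρ₁ x) x
        = (ρ x - branchSum G d 1 ρ₀ x) / δ - branchSum G d 1 ρ₁ x := by
      simp only [div_eq_inv_mul]
      rw [branchSum_sub (fun t => δ⁻¹ * (ρ t - ρ₀ t)) ρ₁,
        branchSum_const_mul δ⁻¹ (fun t => ρ t - ρ₀ t), branchSum_sub ρ ρ₀, hρfix]
    rw [h1]
    simp only [hS0, hS1, hN, hfix]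
    ring
  · have h1 := hfo0 δ s F G r hδ1 hs1 h hF hrd hr0 hr1 x
    have h2 := hfo1 δ s F G r hδ1 hs1 h hF hrd hr0 hr1 x
    rw [heq] at h1
    have h3 : |(S0 x + δ * -N x) / δ| ≤ K3 * (s + |δ|) := by
      rw [abs_div, div_le_iff₀ hδa]
      exact h1.trans_eq (by ring)
    have h4 : (S0 x + δ * -N x) / δ = S0 x / δ - N x := by field_simp; ring
    rw [h4] at h3
    have h5 : |S1 x| ≤ |δ| * B + K4 * |δ| * (s + |δ|) := by
      have h6 := abs_mul_le_mul (le_refl |δ|) (hM1 x)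
      have h7 := abs_sub (S1 x + δ * deriv (branchSum G₀ d 1 fun t => ρ₁ t * ε t) x)
        (δ * deriv (branchSum G₀ d 1 fun t => ρ₁ t * ε t) x)
      rw [add_sub_cancel_right] at h7
      linarith
    have h8 : K3 * (s + |δ|) ≤ K3 * (2 * κ) := mul_le_mul_of_nonneg_left (by linarith) hK3.le
    have h9 : |δ| * B ≤ κ * B := mul_le_mul_of_nonneg_right hδ.le hB.le
    have h10 : K4 * |δ| * (s + |δ|) ≤ K4 * κ * 2 :=
      mul_le_mul (mul_le_mul_of_nonneg_left hδ.le hK4.le) (by linarith) (by positivity)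
        (by positivity)
    exact (abs_add_le _ _).trans (by linarith)
  · have h1 := hlip0 _ F G (hσκ.trans hκ2) h c0 c1 c2 x y
    have h2 := hlip1 _ F G (hσκ.trans hκ2) h c0 c1 c2 x y
    have h3 := hlipN x y
    have h4 : |(S0 x - S0 y) / δ| ≤ K1 * (A + 1) * |x - y| := by
      rw [abs_div, div_le_iff₀ hδa]
      exact h1.trans_eq (by ring)
    have h5 : K2 * ((A + 1) * |δ|) * |x - y| ≤ K2 * |x - y| :=
      mul_le_mul_of_nonneg_right (mul_le_of_le_one_right hK2.le (hσκ.trans hκ2)) (abs_nonneg _)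
    have e1 : S0 x / δ - N x + S1 x - (S0 y / δ - N y + S1 y)
        = (S0 x - S0 y) / δ - (N x - N y) + (S1 x - S1 y) := by ring
    rw [e1, hL]
    refine (abs_add_le _ _).trans ((add_le_add (abs_sub _ _) le_rfl).trans ?_)
    linarith

/-! ### Families of expanding maps -/

theorem abs_iteratedDeriv_le_c3Norm {r : UnitAddCircle → ℝ} (hr : IsCk 3 r) {j : ℕ} (hj : j < 4)
    (t : ℝ) : |iteratedDeriv j (fun s : ℝ => r (s : UnitAddCircle)) t| ≤ c3Norm r := by
  have hp : ∀ i : ℕ, Function.Periodic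
      (iteratedDeriv i fun s : ℝ => r (s : UnitAddCircle)) 1 := by
    intro i
    induction i with
    | zero => rw [iteratedDeriv_zero]; exact periodic_lift r
    | succ i ih => rw [iteratedDeriv_succ]; exact periodic_deriv ih
  have hb : ∀ i ∈ Finset.range 4, BddAbove
      (Set.range fun t : ℝ => |iteratedDeriv i (fun s : ℝ => r (s : UnitAddCircle)) t|) := by
    intro i hi
    have hi' : i ≤ 3 := by have := Finset.mem_range.1 hi; omega
    obtain ⟨M, -, hM⟩ := exists_abs_le_of_periodic (hp i)
      (hr.continuous_iteratedDeriv i (by exact_mod_cast hi'))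
    exact ⟨M, by rintro _ ⟨t, rfl⟩; exact hM t⟩
  refine (le_ciSup (hb j (Finset.mem_range.2 hj)) t).trans ?_
  exact Finset.single_le_sum
    (f := fun j => ⨆ t : ℝ, |iteratedDeriv j (fun s : ℝ => r (s : UnitAddCircle)) t|)
    (fun i _ => Real.iSup_nonneg fun t => abs_nonneg _) (Finset.mem_range.2 hj)

theorem c3Norm_zero : c3Norm (fun _ => 0) = 0 := by
  have : ∀ j t, iteratedDeriv j (fun _ : ℝ => (0 : ℝ)) t = 0 := fun j t => by
    rw [iteratedDeriv_const]; split_ifs <;> rfl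
  simp [c3Norm, this]

/-- The affine family `T₀ + δ ε` consists of expanding maps for small `δ`. -/
theorem exists_isPerturbation {T₀ : UnitAddCircle → UnitAddCircle} (hT₀ : IsExpandingMap 3 T₀)
    {ε : UnitAddCircle → ℝ} (hε : IsCk 3 ε) : ∃ η T, IsPerturbation T₀ ε η T := by
  obtain ⟨d, F, G, h, hFT⟩ := hT₀.exists_liftPair (by norm_num)
  obtain ⟨l, D, hl, hF, -, -⟩ := h.exists_deriv_bounds (by norm_num)
  obtain ⟨B, hB, hεB⟩ := exists_abs_le_of_periodic (periodic_deriv (periodic_lift ε))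
    (hε.continuous_deriv (by norm_num))
  refine ⟨(l - 1) / B, fun δ x => T₀ x + ((δ * ε x : ℝ) : UnitAddCircle),
    div_pos (by linarith) hB, by simp, fun δ hδ => ?_, fun _ _ => 0, fun δ _ => ⟨?_, ?_⟩, ?_⟩
  · refine ⟨fun t => F t + δ * ε (t : UnitAddCircle), ?_, fun t => ?_, fun t => ?_⟩
    · exact h.contDiff.add (contDiff_const.mul hε)
    · rw [AddCircle.coe_add, hFT]
    · have h1 : HasDerivAt (fun t : ℝ => F t + δ * ε (t : UnitAddCircle)) _ t :=
        (h.differentiable (by norm_num) t).hasDerivAt.fun_add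
          (((hε.differentiable (by norm_num)) t).hasDerivAt.const_mul δ)
      rw [h1.deriv]
      have h2 : |δ| < (l - 1) / B := abs_lt.2 hδ
      rw [lt_div_iff₀ hB] at h2
      have h3 := (abs_le.1 (abs_mul_le_mul (le_refl |δ|) (hεB t))).1
      linarith [hF t]
  · exact contDiff_const
  · intro x; simp
  · simp [c3Norm_zero]

end CircleResponse

open CircleResponse in
theorem corollary1 (T₀ : UnitAddCircle → UnitAddCircle)
    (hT₀ : CircleResponse.IsExpandingMap 5 T₀)
    (ρ₁ : UnitAddCircle → ℝ) (hρ₁ : CircleResponse.IsCk 3 ρ₁) (hmean : ∫ x, ρ₁ x = 0) :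
    ∃ ε : UnitAddCircle → ℝ, CircleResponse.IsCk 4 ε ∧ CircleResponse.Realises T₀ ε ρ₁ := by
  obtain ⟨d, F₀, G₀, h₀, hFT₀⟩ := hT₀.exists_liftPair (by norm_num)
  obtain ⟨l, D, hl, hFl, hD, hFD⟩ := h₀.exists_deriv_bounds (by norm_num)
  have hG₀ := h₀.inverseLift (by norm_num) hl hFl hD hFD
  obtain ⟨w₀, hw₀u, hw₀, hw₀fix, hw₀pos⟩ :=
    exists_isUniqueInvariantDensity (m := 4) (by norm_num) hT₀
  have hw₀fix' : ∀ x, branchSum G₀ d 1 (fun t : ℝ => w₀ (t : UnitAddCircle)) x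
      = w₀ (x : UnitAddCircle) := fun x => by
    rw [← h₀.transfer_eq hFT₀ (by norm_num), hw₀fix]
  obtain ⟨ε', hε', hεp, heq⟩ := h₀.exists_perturbation hG₀ hw₀ (periodic_lift w₀)
    (fun x => hw₀pos x) hw₀fix' hρ₁ (periodic_lift ρ₁)
  have hlift : (fun t : ℝ => hεp.lift (t : UnitAddCircle)) = ε' := funext fun t => hεp.lift_coe t
  have hεk : IsCk 4 hεp.lift := by rw [IsCk, hlift]; exact hε'
  have hT₀3 : IsExpandingMap 3 T₀ := by
    obtain ⟨F, h1, h2, h3⟩ := hT₀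
    exact ⟨F, h1.of_le (by norm_num), h2, h3⟩
  refine ⟨hεp.lift, hεk, exists_isPerturbation hT₀3 (hεk.of_le (by norm_num)),
    fun η T hT => ?_⟩
  have hex : ∀ δ : ℝ, ∃ w, δ ∈ Set.Ioo (-η) η → IsUniqueInvariantDensity (T δ) w ∧
      (∀ x, transfer (T δ) w x = w x) := by
    intro δ
    by_cases hδ : δ ∈ Set.Ioo (-η) η
    · obtain ⟨w, h1, -, h2, -⟩ :=
        exists_isUniqueInvariantDensity (m := 2) le_rfl (hT.expanding δ hδ)
      exact ⟨w, fun _ => ⟨h1, h2⟩⟩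
    · exact ⟨0, fun h => absurd h hδ⟩
  choose f hf using hex
  -- at `δ = 0` the density from which `ε` was built is used, elsewhere any choice
  refine ⟨fun δ => if δ = 0 then w₀ else f δ, fun δ hδ => ?_, ?_⟩
  · by_cases h0 : δ = 0
    · simpa [h0, hT.zero] using hw₀u
    · simpa [h0] using (hf δ hδ).1
  obtain ⟨r, hr, hrlim⟩ := hT.expansion
  rw [Metric.tendsto_nhds]
  intro e he
  obtain ⟨κ, hκ, hmain⟩ := (h₀.of_le (by norm_num : 3 ≤ 5)).exists_response_bound
    (hw₀.of_le (by norm_num)) (periodic_lift w₀)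
    ((integral_circle_eq w₀).symm.trans hw₀u.invariant.integral_eq_one) hw₀fix'
    (hρ₁.of_le (by norm_num)) (periodic_lift ρ₁) ((integral_circle_eq ρ₁).symm.trans hmean)
    (hε'.of_le (by norm_num)) hεp heq (half_pos he)
  have hη : ∀ᶠ δ in 𝓝[≠] (0 : ℝ), δ ∈ Set.Ioo (-η) η :=
    nhdsWithin_le_nhds (Ioo_mem_nhds (by linarith [hT.pos]) hT.pos)
  have hκ' : ∀ᶠ δ in 𝓝[≠] (0 : ℝ), δ ∈ Set.Ioo (-κ) κ :=
    nhdsWithin_le_nhds (Ioo_mem_nhds (by linarith) hκ)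
  filter_upwards [hη, hκ', self_mem_nhdsWithin, hrlim.eventually_lt_const hκ]
    with δ hδη hδκ hδ0 hrκ
  have hδ0' : δ ≠ 0 := hδ0
  obtain ⟨hrk, hrT⟩ := hr δ hδη
  obtain ⟨hfu, hffix⟩ := hf δ hδη
  set F : ℝ → ℝ := fun t => F₀ t + (δ * ε' t + r δ (t : UnitAddCircle)) with hF
  have hFT : ∀ t : ℝ, ((F t : ℝ) : UnitAddCircle) = T δ (t : UnitAddCircle) := fun t => by
    rw [hF, AddCircle.coe_add, hFT₀, hrT, hεp.lift_coe]
  have hFc : ContDiff ℝ 3 F :=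
    (h₀.contDiff.of_le (by norm_num)).add ((contDiff_const.mul (hε'.of_le (by norm_num))).add hrk)
  have hF1 : ∀ t, F (t + 1) = F t + d := fun t => by
    simp only [hF, h₀.add_one, hεp t, coe_add_one]
    ring
  -- the derivative does not depend on the lift
  have hFd : ∀ t, 1 < deriv F t := fun t => by
    obtain ⟨F₁, h1, h2, h3⟩ := hT.expanding δ hδη
    rw [← circleDeriv_eq_deriv (hFc.differentiable (by norm_num)) hFT,
      circleDeriv_eq_deriv (h1.differentiable (by norm_num)) h2]
    exact h3 t
  obtain ⟨G, h⟩ := exists_liftPair (k := 3) (by norm_num) hFc hF1 hFd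
  have hs : c3Norm (r δ) / |δ| * |δ| = c3Norm (r δ) :=
    div_mul_cancel₀ _ (abs_ne_zero.2 hδ0')
  have hbound := hmain δ (c3Norm (r δ) / |δ|) F G (fun t => r δ (t : UnitAddCircle))
    (fun t => f δ (t : UnitAddCircle)) hδ0' (abs_lt.2 hδκ) hrκ (h.of_le (by norm_num))
    (fun t => rfl) (hrk.of_le (by norm_num))
    (fun t => by rw [hs]; simpa using abs_iteratedDeriv_le_c3Norm hrk (j := 0) (by norm_num) t)
    (fun t => by rw [hs]; simpa using abs_iteratedDeriv_le_c3Norm hrk (j := 1) (by norm_num) t)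
    (fun t => by
      rw [hs]
      simpa [iteratedDeriv_succ] using abs_iteratedDeriv_le_c3Norm hrk (j := 2) (by norm_num) t)
    (hfu.smooth.of_le (by norm_num)) (periodic_lift _)
    ((integral_circle_eq _).symm.trans hfu.invariant.integral_eq_one)
    (fun x => by rw [← h.transfer_eq hFT (by norm_num), hffix])
  have hint : ‖∫ x, |(f δ x - w₀ x) / δ - ρ₁ x|‖ ≤ e / 2 := by
    have := norm_integral_le_of_norm_le_const (μ := (volume : Measure UnitAddCircle))
      (f := fun x => |(f δ x - w₀ x) / δ - ρ₁ x|) (C := e / 2) (Eventually.of_forall fun x => by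
        obtain ⟨t, rfl⟩ := QuotientAddGroup.mk_surjective x
        rw [Real.norm_eq_abs, abs_abs]
        exact hbound t)
    rwa [Measure.real, UnitAddCircle.measure_univ, ENNReal.toReal_one, mul_one] at this
  simp only [hδ0', if_false, if_true, dist_zero_right]
  linarith
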